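/- Consider, for a function $b=b(\tau,x)$ of $\tau\ge 0$ and $x\in[-\pi,\pi]$, the reduced incompressible porous medium equation $$\partial_\tau b+\Big(\int_{-\pi}^x b(\tau,\bar x)\,d\bar x\Big)\partial_x b-b^2+\frac1\pi\int_{-\pi}^{\pi}b^2\,dx=\frac1\pi\Big(\int_0^\tau\!\int_{-\pi}^{\pi}b^2\,dx\,d\bar\tau\Big)\,b .\qquad(1)$$ For $0<T<\infty$, a $C^3$ solution on $[0,T)$ with initial datum $b_0$ is a function $b\in C([0,T);C^3([-\pi,\pi]))$ with $b(0,\cdot)=b_0$ that satisfies (1) at every point of $[0,T)\times[-\pi,\pi]$ (with one-sided derivatives at the boundary). Let $\|f\|_{C^k([-\pi,\pi])}=\sum_{j\le k}\sup_{[-\pi,\pi]}|f^{(j)}|$. **Theorem.** There exist $\delta>0$ and $C>0$ such that for every $\mu>0$ the following holds. Let $b_0\in C^3([-\pi,\pi])$ satisfy $\int_{-\pi}^{\pi}b_0\,dx=0$ and $$\|b_0-\mu\cos\|_{C^3([-\pi,\pi])}\le\delta\mu .$$ Then there is a finite time $\tau^*>0$ and a $C^3$ solution $b$ of (1) on $[0,\tau^*)$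 with initial datum $b_0$, which satisfies the mean-free condition $\int_{-\pi}^{\pi}b(\tau,x)\,dx=0$ for all $\tau\in[0,\tau^*)$ and which is the unique maximal one: every $C^3$ solution of (1) on an interval $[0,T)$ with initial datum $b_0$ has $T\le\tau^*$ and coincides with $b$ on $[0,T)\times[-\pi,\pi]$. The solution $b$ blows up at time $\tau^*$, that is, $\sup_{x\in[-\pi,\pi]}|b(\tau,x)|\to\infty$ as $\tau\uparrow\tau^*$. Moreover $$b(\tau,x)=\frac{\cos x}{\tau^*-\tau}+\tilde b(\tau,x),\qquad \|\tilde b(\tau)\|_{C^1([-\pi,\pi])}\le C\,\mu^{1/4}\,(\tau^*-\tau)^{-3/4}\qquad\text{for all }\tau\in[0,\tau^*).$$ -/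

import Mathlib

open Set Filter Topology

noncomputable section

namespace ReducedIPM

/-- The spatial domain `Ω = [-π, π]`. -/
def Om : Set ℝ := Icc (-Real.pi) Real.pi

/-- The `C^k([-π, π])` norm: the sum over `j ≤ k` of the supremum over `[-π, π]` of the absolute
value of the `j`-th derivative (one-sided at the end points). It is used for functions that are
`C^k` on `[-π, π]`, for which all the suprema are finite. -/
def ckNorm (k : ℕ) (f : ℝ → ℝ) : ℝ :=
  ∑ j ∈ Finset.range (k + 1), ⨆ x : Om, |iteratedDerivWithin j f Om (x : ℝ)|

/-- The value that the equation prescribes for `∂_τ b (τ, x)`: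
`-(∫_{-π}^x b) ∂ₓ b + b² - (1/π) ∫_{-π}^π b² + (1/π) (∫_0^τ ∫_{-π}^π b²) b`. -/
def rhs (b : ℝ → ℝ → ℝ) (τ x : ℝ) : ℝ :=
  -(∫ y in (-Real.pi)..x, b τ y) * derivWithin (b τ) Om x + b τ x ^ 2
    - (1 / Real.pi) * (∫ y in (-Real.pi)..Real.pi, b τ y ^ 2)
    + (1 / Real.pi) * (∫ s in (0 : ℝ)..τ, ∫ y in (-Real.pi)..Real.pi, b s y ^ 2) * b τ x

/-- `b` (a function of time and space, of which only the values on `[0, T) × [-π, π]` matter) is a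
`C³` solution on the time interval `[0, T)` of the reduced equation with initial datum `b₀`, that
is, `τ ↦ b(τ, ·)` is continuous on `[0, T)` with values in `C³([-π, π])`, it starts from `b₀`, and
the equation holds at every point of `[0, T) × [-π, π]`. -/
structure IsC3Solution (b₀ : ℝ → ℝ) (T : ℝ) (b : ℝ → ℝ → ℝ) : Prop where
  contDiffOn : ∀ τ ∈ Ico 0 T, ContDiffOn ℝ 3 (b τ) Om
  continuousOn : ∀ j : ℕ, j ≤ 3 →
    ContinuousOn (fun p : ℝ × ℝ => iteratedDerivWithin j (b p.1) Om p.2) (Ico 0 T ×ˢ Om)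
  initial : ∀ x ∈ Om, b 0 x = b₀ x
  equation : ∀ τ ∈ Ico 0 T, ∀ x ∈ Om,
    HasDerivWithinAt (fun s => b s x) (rhs b τ x) (Ici 0) τ

end ReducedIPM

end

/-! Along the flow of the velocity `∫_{-π}^x b` the equation can be integrated. Let `X` be the flow
map, `y = 1/∂_α X` and `E = (1/π) ∫_0^τ ∫ b²`. Then `∂_τ y = -b y`, and the equation turns into
`∂_τ² y = ∂_τ (E y)`, so that `∂_τ y - E y = -b₀`. Hence `y = G (1 - η b₀(α))`, where `∂_τ G = E G`
and `∂_τ η = 1/G`. Since the flow of a mean-free solution fixes `±π`, `∂_α X` has mean one, and `G`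
must be the mean of `1/(1 - η b₀)`. Everything is thus explicit in the parameter `η`, with `τ = ∫ G
dη`. The proof takes these formulas as definitions and verifies the equation
(`IsAmplitude.hasDerivAt_vel_param`, `IsAmplitude.isC3Solution`).

Uniqueness (`IsEvolution.eqOn`) is a Grönwall estimate for the squared `L²` distance of two
solutions plus the squared difference of their nonlocal terms `E`. It uses that one of the two, here
the explicit one, is mean-free.

The solution ends when `η` reaches `1/m`, with `m = max b₀` attained at `a`. Put `r = √(1 - η m)`.
For data near `μ cos` the maximum is unique and nondegenerate, and `1 - η b₀` is close to `r² + A (α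
- a)²`. For this quadratic model all integrals are arctangents: the mean is about `1/(2 √A r)`, the
flow is about `2 arctan(√A (α - a)/r)`, and `m (τ* - τ)` is about `r/√A`. By the double-angle
formula `∂ₓ b = b₀'/(1 - η b₀)` becomes `-sin x/(τ* - τ)`, whatever `A` and `a` are; this
universality is why the profile is exactly the cosine (`IsProfile.abs_deriv_sub_sin_le`). The errors
are of relative size `√r`, a crude bound for `r log(1/r)`. The remainder is mean-free, so a bound on
its derivative controls its `C¹` norm. Blow-up follows at `x = 0`, and maximality follows from
blow-up and uniqueness. -/

namespace ReducedIPM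

open Real MeasureTheory

/-! ### Calculus tools: roots, parameter integrals, derivatives up to the boundary -/

/-- If `F p` is strictly increasing on `I` for `p` near `p₀`, and `F` is continuous in `p`, then the
root of `F p` in `I` depends continuously on `p`. -/
theorem continuousAt_root_of_strictMonoOn {P : Type*} [TopologicalSpace P] {F : P → ℝ → ℝ}
    {g : P → ℝ} {p₀ : P} {I : Set ℝ} (hI : I ∈ 𝓝 (g p₀))
    (hF : ∀ᶠ p in 𝓝 p₀, StrictMonoOn (F p) I) (hg : ∀ᶠ p in 𝓝 p₀, g p ∈ I)
    (hroot : ∀ᶠ p in 𝓝 p₀, F p (g p) = 0)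
    (hc : ∀ α ∈ I, ContinuousAt (fun p => F p α) p₀) : ContinuousAt g p₀ := by
  rw [ContinuousAt, (nhds_basis_Ioo_pos (g p₀)).tendsto_right_iff]
  intro e he
  obtain ⟨d, hd, hdI⟩ := (nhds_basis_Icc_pos (g p₀)).mem_iff.1 hI
  set k := min d (e / 2)
  have hk : 0 < k := lt_min hd (by linarith)
  have hkd : k ≤ d := min_le_left _ _
  have hke : k ≤ e / 2 := min_le_right _ _
  have h1 : g p₀ - k ∈ I := hdI ⟨by linarith, by linarith⟩
  have h2 : g p₀ + k ∈ I := hdI ⟨by linarith, by linarith⟩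
  have h0 := hroot.self_of_nhds
  have hs := hF.self_of_nhds
  have h3 : F p₀ (g p₀ - k) < 0 := by
    rw [← h0]; exact hs h1 (mem_of_mem_nhds hI) (by linarith)
  have h4 : 0 < F p₀ (g p₀ + k) := by
    rw [← h0]; exact hs (mem_of_mem_nhds hI) h2 (by linarith)
  filter_upwards [hF, hg, hroot, (hc _ h1).eventually_lt continuousAt_const h3,
    continuousAt_const.eventually_lt (hc _ h2) h4] with p hp hpI hp0 hp1 hp2
  constructor
  · by_contra! h
    have := hp.monotoneOn hpI h1 (by linarith)
    linarith
  · by_contra! h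
    have := hp.monotoneOn h2 hpI (by linarith)
    linarith

/-- Where `f` vanishes the slope of the product is the slope of `f` times `g`, so mere continuity of
`g` suffices. In the derivative of the label, `g` is the inverse of an averaged Jacobian, whose
differentiability is thereby not needed. -/
theorem HasDerivAt.mul_of_eq_zero {f g : ℝ → ℝ} {f' x : ℝ} (hf : HasDerivAt f f' x)
    (h0 : f x = 0) (hg : ContinuousAt g x) : HasDerivAt (fun y => f y * g y) (f' * g x) x := by
  rw [hasDerivAt_iff_tendsto_slope] at hf ⊢
  have : slope (fun y => f y * g y) x = fun y => slope f x y * g y := by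
    ext y
    simp only [slope_def_field, h0]
    ring
  rw [this]
  exact hf.mul (hg.tendsto.mono_left nhdsWithin_le_nhds)

theorem hasDerivAt_integral_of_continuousOn {F F' : ℝ → ℝ → ℝ} {I : Set ℝ} (hI : IsOpen I)
    (hF : ∀ η ∈ I, Continuous (F η))
    (hF' : ContinuousOn (fun p : ℝ × ℝ => F' p.1 p.2) (I ×ˢ univ))
    (hd : ∀ η ∈ I, ∀ α, HasDerivAt (fun s => F s α) (F' η α) η) (a b : ℝ) {η : ℝ} (hη : η ∈ I) :
    HasDerivAt (fun s => ∫ α in a..b, F s α) (∫ α in a..b, F' η α) η := by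
  obtain ⟨d, hd0, hdI⟩ := (nhds_basis_Icc_pos η).mem_iff.1 (hI.mem_nhds hη)
  obtain ⟨C, hC⟩ := (isCompact_Icc.prod isCompact_uIcc).exists_bound_of_continuousOn
    (hF'.mono (prod_mono hdI (subset_univ (uIcc a b))))
  have hF'c : Continuous (F' η) := by
    have h : ContinuousOn (fun α : ℝ => F' η α) univ :=
      hF'.comp (f := fun α : ℝ => ((η, α) : ℝ × ℝ)) (by fun_prop) (fun α _ => ⟨hη, mem_univ _⟩)
    exact continuousOn_univ.1 h
  refine (intervalIntegral.hasDerivAt_integral_of_dominated_loc_of_deriv_le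
    (F := F) (F' := F') (s := Icc (η - d) (η + d)) (bound := fun _ => C)
    (Icc_mem_nhds (by linarith) (by linarith)) ?_
    ((hF η hη).intervalIntegrable a b) hF'c.aestronglyMeasurable ?_ (by simp) ?_).2
  · filter_upwards [hI.mem_nhds hη] with s hs
    exact (hF s hs).aestronglyMeasurable
  · refine Eventually.of_forall fun t ht s hs => ?_
    exact hC (s, t) ⟨hs, uIoc_subset_uIcc ht⟩
  · exact Eventually.of_forall fun t _ s hs => hd s (hdI hs) t

theorem uniqueDiffOn_Om : UniqueDiffOn ℝ Om :=
  uniqueDiffOn_Icc (by linarith [pi_pos])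

theorem contDiffOn_three_of_hasDerivWithinAt {d : ℕ → ℝ → ℝ}
    (hd : ∀ j < 3, ∀ x ∈ Om, HasDerivWithinAt (d j) (d (j + 1) x) Om x)
    (hc : ContinuousOn (d 3) Om) :
    ContDiffOn ℝ 3 (d 0) Om ∧ ∀ j ≤ 3, EqOn (iteratedDerivWithin j (d 0) Om) (d j) Om := by
  have key : ∀ j ≤ 3, EqOn (iteratedDerivWithin j (d 0) Om) (d j) Om := by
    intro j
    induction j with
    | zero => intro _ x _; simp
    | succ n ih =>
      intro hn x hx
      have ih' := ih (by omega)
      rw [iteratedDerivWithin_succ, derivWithin_congr ih' (ih' hx)]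
      exact (hd n (by omega) x hx).derivWithin (uniqueDiffOn_Om x hx)
  refine ⟨?_, key⟩
  have h3 : ((3 : ℕ) : WithTop ℕ∞) = 3 := rfl
  rw [← h3, contDiffOn_nat_iff_continuousOn_differentiableOn_deriv uniqueDiffOn_Om]
  constructor
  · intro j hj
    refine ContinuousOn.congr ?_ (key j hj)
    rcases hj.lt_or_eq with h | rfl
    · exact fun x hx => (hd j h x hx).continuousWithinAt
    · exact hc
  · intro j hj
    refine DifferentiableOn.congr ?_ (key j hj.le)
    exact fun x hx => (hd j hj x hx).differentiableWithinAt

theorem hasDerivWithinAt_iteratedDerivWithin {f : ℝ → ℝ} (hf : ContDiffOn ℝ 3 f Om) {j : ℕ}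
    (hj : j < 3) {x : ℝ} (hx : x ∈ Om) :
    HasDerivWithinAt (iteratedDerivWithin j f Om) (iteratedDerivWithin (j + 1) f Om x) Om x := by
  rw [iteratedDerivWithin_succ]
  exact (hf.differentiableOn_iteratedDerivWithin (by exact_mod_cast hj) uniqueDiffOn_Om x
    hx).hasDerivWithinAt

theorem bddAbove_iteratedDerivWithin {f : ℝ → ℝ} {n : ℕ} (hf : ContDiffOn ℝ n f Om) {j : ℕ}
    (hj : j ≤ n) : BddAbove (range fun x : Om => |iteratedDerivWithin j f Om (x : ℝ)|) := by
  have h := hf.continuousOn_iteratedDerivWithin (m := j) (by exact_mod_cast hj) uniqueDiffOn_Om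
  obtain ⟨C, hC⟩ := (isCompact_Icc (a := -π) (b := π)).exists_bound_of_continuousOn h
  refine ⟨C, ?_⟩
  rintro _ ⟨x, rfl⟩
  exact hC x x.2

theorem abs_iteratedDerivWithin_le_ckNorm {f : ℝ → ℝ} {n : ℕ} (hf : ContDiffOn ℝ n f Om) {j : ℕ}
    (hj : j ≤ n) {x : ℝ} (hx : x ∈ Om) : |iteratedDerivWithin j f Om x| ≤ ckNorm n f := by
  have h1 : |iteratedDerivWithin j f Om x| ≤ ⨆ x : Om, |iteratedDerivWithin j f Om (x : ℝ)| :=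
    le_ciSup (bddAbove_iteratedDerivWithin hf hj) (⟨x, hx⟩ : Om)
  refine h1.trans (Finset.single_le_sum
    (f := fun j => ⨆ x : Om, |iteratedDerivWithin j f Om (x : ℝ)|)
    (fun i _ => ?_) (Finset.mem_range.2 (by omega)))
  exact Real.iSup_nonneg fun x => abs_nonneg _

/-! ### The explicit solution: Jacobian, flow map and labels -/

/-- A continuous function on the line with values in `[-2m, m]`, from which the explicit solution is
built. -/
structure IsAmplitude (β : ℝ → ℝ) (m : ℝ) : Prop where
  cont : Continuous β
  pos : 0 < m
  lower : ∀ α, -2 * m ≤ β α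
  upper : ∀ α, β α ≤ m

/-- The interval of parameters in which the explicit solution lives. -/
def paramRange (m : ℝ) : Set ℝ := Ioo (-(1 / (2 * m))) (1 / m)

/-- The unnormalised Jacobian of the flow map at the label `α`. -/
noncomputable def jac (β : ℝ → ℝ) (η α : ℝ) : ℝ := (1 - η * β α)⁻¹

/-- Moments of the Jacobian. -/
noncomputable def moment (β g : ℝ → ℝ) (n : ℕ) (a b η : ℝ) : ℝ := ∫ α in a..b, g α * jac β η α ^ n

noncomputable def meanJac (β : ℝ → ℝ) (η : ℝ) : ℝ := (2 * π)⁻¹ * moment β (fun _ => 1) 1 (-π) π η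

noncomputable def meanJac₁ (β : ℝ → ℝ) (η : ℝ) : ℝ := (2 * π)⁻¹ * moment β β 2 (-π) π η

noncomputable def meanJac₂ (β : ℝ → ℝ) (η : ℝ) : ℝ :=
  (2 * π)⁻¹ * moment β (fun α => 2 * (β α * β α)) 3 (-π) π η

/-- The flow map, parametrised by `η`. -/
noncomputable def flow (β : ℝ → ℝ) (η α : ℝ) : ℝ := -π + moment β (fun _ => 1) 1 (-π) α η / meanJac β η

/-- The inverse of the flow map. -/
noncomputable def label (β : ℝ → ℝ) (η x : ℝ) : ℝ := Function.invFun (flow β η) x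

/-- The physical time at the parameter `η`. -/
noncomputable def physTime (β : ℝ → ℝ) (η : ℝ) : ℝ := ∫ s in (0 : ℝ)..η, meanJac β s

/-- The explicit solution, parametrised by `η`. -/
noncomputable def vel (β : ℝ → ℝ) (η x : ℝ) : ℝ :=
  (β (label β η x) * jac β η (label β η x) - meanJac₁ β η / meanJac β η) / meanJac β η

section

variable {β : ℝ → ℝ} {m : ℝ}

theorem isOpen_paramRange (m : ℝ) : IsOpen (paramRange m) := isOpen_Ioo

theorem IsAmplitude.zero_mem (h : IsAmplitude β m) : (0 : ℝ) ∈ paramRange m := by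
  have := h.pos
  exact ⟨by rw [neg_lt_zero]; positivity, by positivity⟩

/-- The end `1/m` is fixed by the upper bound on `β`, the end `-1/(2m)` by the lower one. Letting
`η` be slightly negative makes `η = 0` an interior point, so that two-sided derivatives are
available at the initial time. -/
theorem IsAmplitude.one_sub_pos (h : IsAmplitude β m) {η : ℝ} (hη : η ∈ paramRange m) (α : ℝ) :
    0 < 1 - η * β α := by
  have hm := h.pos
  have h1 : η * m < 1 := (lt_div_iff₀ hm).1 hη.2
  have h2 : -1 < η * (2 * m) := by
    have h3 := (div_lt_iff₀ (show 0 < 2 * m by positivity)).1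
      (show -1 / (2 * m) < η by rw [neg_div]; exact hη.1)
    exact h3
  rcases le_total 0 η with h0 | h0
  · nlinarith [mul_le_mul_of_nonneg_left (h.upper α) h0]
  · nlinarith [mul_le_mul_of_nonpos_left (h.lower α) h0]

theorem IsAmplitude.one_sub_le (h : IsAmplitude β m) {η : ℝ} (hη : η ∈ paramRange m) (α : ℝ) :
    1 - η * β α ≤ 3 := by
  have hm := h.pos
  have h1 : η * m < 1 := (lt_div_iff₀ hm).1 hη.2
  have h2 : -1 < η * (2 * m) := by
    have h3 := (div_lt_iff₀ (show 0 < 2 * m by positivity)).1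
      (show -1 / (2 * m) < η by rw [neg_div]; exact hη.1)
    exact h3
  rcases le_total 0 η with h0 | h0
  · nlinarith [mul_le_mul_of_nonneg_left (h.lower α) h0]
  · nlinarith [mul_le_mul_of_nonpos_left (h.upper α) h0]

theorem IsAmplitude.jac_pos (h : IsAmplitude β m) {η : ℝ} (hη : η ∈ paramRange m) (α : ℝ) :
    0 < jac β η α := inv_pos.2 (h.one_sub_pos hη α)

theorem IsAmplitude.jac_ge (h : IsAmplitude β m) {η : ℝ} (hη : η ∈ paramRange m) (α : ℝ) :
    1 / 3 ≤ jac β η α := by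
  rw [jac, ← one_div]
  exact one_div_le_one_div_of_le (h.one_sub_pos hη α) (h.one_sub_le hη α)

theorem IsAmplitude.continuousOn_jac (h : IsAmplitude β m) :
    ContinuousOn (fun p : ℝ × ℝ => jac β p.1 p.2) (paramRange m ×ˢ univ) := by
  have := h.cont
  unfold jac
  exact ContinuousOn.inv₀ (by fun_prop) fun p hp => (h.one_sub_pos hp.1 p.2).ne'

theorem IsAmplitude.continuous_jac (h : IsAmplitude β m) {η : ℝ} (hη : η ∈ paramRange m) :
    Continuous (jac β η) := by
  have := h.cont
  unfold jac
  exact Continuous.inv₀ (by fun_prop) fun α => (h.one_sub_pos hη α).ne'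

theorem IsAmplitude.hasDerivAt_jac (h : IsAmplitude β m) {η : ℝ} (hη : η ∈ paramRange m) (α : ℝ) :
    HasDerivAt (fun s => jac β s α) (β α * jac β η α ^ 2) η := by
  have h1 : HasDerivAt (fun s => 1 - s * β α) (-(1 * β α)) η :=
    ((hasDerivAt_id η).mul_const (β α)).const_sub 1
  have h0 := (h.one_sub_pos hη α).ne'
  refine (h1.inv h0).congr_deriv ?_
  simp only [jac]
  field_simp

theorem IsAmplitude.continuous_integrand (h : IsAmplitude β m) {η : ℝ} (hη : η ∈ paramRange m)
    {g : ℝ → ℝ} (hg : Continuous g) (n : ℕ) : Continuous fun α => g α * jac β η α ^ n :=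
  hg.mul ((h.continuous_jac hη).pow n)

theorem IsAmplitude.hasDerivAt_moment (h : IsAmplitude β m) {g : ℝ → ℝ} (hg : Continuous g) (n : ℕ)
    (a b : ℝ) {η : ℝ} (hη : η ∈ paramRange m) :
    HasDerivAt (moment β g n a b)
      (moment β (fun α => n * (g α * β α)) (n + 1) a b η) η := by
  have hc := h.cont
  refine hasDerivAt_integral_of_continuousOn (isOpen_paramRange m)
    (F := fun s α => g α * jac β s α ^ n)
    (F' := fun s α => n * (g α * β α) * jac β s α ^ (n + 1))
    (fun s hs => h.continuous_integrand hs hg n) ?_ ?_ a b hη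
  · exact ContinuousOn.mul (by fun_prop) (h.continuousOn_jac.pow (n + 1))
  · intro s hs α
    refine (((h.hasDerivAt_jac hs α).pow n).const_mul (g α)).congr_deriv ?_
    rcases n with _ | n
    · simp
    · push_cast [Nat.add_sub_cancel]
      ring

theorem IsAmplitude.hasDerivAt_moment_right (h : IsAmplitude β m) {g : ℝ → ℝ} (hg : Continuous g)
    (n : ℕ) (a b : ℝ) {η : ℝ} (hη : η ∈ paramRange m) :
    HasDerivAt (fun b => moment β g n a b η) (g b * jac β η b ^ n) b :=
  intervalIntegral.integral_hasDerivAt_right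
    ((h.continuous_integrand hη hg n).intervalIntegrable a b)
    ((h.continuous_integrand hη hg n).stronglyMeasurableAtFilter _ _)
    (h.continuous_integrand hη hg n).continuousAt

theorem IsAmplitude.hasDerivAt_moment_zero (h : IsAmplitude β m) (a b : ℝ) {η : ℝ}
    (hη : η ∈ paramRange m) :
    HasDerivAt (moment β (fun _ => 1) 1 a b) (moment β β 2 a b η) η := by
  have := h.hasDerivAt_moment (g := fun _ => 1) continuous_const 1 a b hη
  simpa using this

theorem IsAmplitude.hasDerivAt_meanJac (h : IsAmplitude β m) {η : ℝ} (hη : η ∈ paramRange m) :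
    HasDerivAt (meanJac β) (meanJac₁ β η) η :=
  (h.hasDerivAt_moment_zero (-π) π hη).const_mul _

theorem IsAmplitude.hasDerivAt_meanJac₁ (h : IsAmplitude β m) {η : ℝ} (hη : η ∈ paramRange m) :
    HasDerivAt (meanJac₁ β) (meanJac₂ β η) η := by
  exact (h.hasDerivAt_moment h.cont 2 (-π) π hη).const_mul (2 * π)⁻¹

theorem IsAmplitude.continuousAt_meanJac₂ (h : IsAmplitude β m) {η : ℝ} (hη : η ∈ paramRange m) :
    ContinuousAt (meanJac₂ β) η := by
  have hc := h.cont
  exact ((h.hasDerivAt_moment (g := fun α => 2 * (β α * β α)) (by fun_prop) 3 (-π) π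
    hη).const_mul (2 * π)⁻¹).continuousAt

theorem IsAmplitude.moment_le (h : IsAmplitude β m) {a b : ℝ} (hab : a ≤ b) {η : ℝ}
    (hη : η ∈ paramRange m) : (b - a) / 3 ≤ moment β (fun _ => 1) 1 a b η := by
  have h1 : ∫ _ in a..b, (1 / 3 : ℝ) ≤ moment β (fun _ => 1) 1 a b η := by
    refine intervalIntegral.integral_mono_on hab (by simp)
      ((h.continuous_integrand hη continuous_const 1).intervalIntegrable a b) fun x _ => ?_
    simpa using h.jac_ge hη x
  rw [intervalIntegral.integral_const, smul_eq_mul] at h1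
  linarith

theorem IsAmplitude.meanJac_pos (h : IsAmplitude β m) {η : ℝ} (hη : η ∈ paramRange m) :
    0 < meanJac β η := by
  have h1 := h.moment_le (a := -π) (b := π) (by linarith [pi_pos]) hη
  have h2 := pi_pos
  exact mul_pos (by positivity) (lt_of_lt_of_le (by linarith) h1)

theorem IsAmplitude.hasDerivAt_flow (h : IsAmplitude β m) {η : ℝ} (hη : η ∈ paramRange m) (α : ℝ) :
    HasDerivAt (flow β η) (jac β η α / meanJac β η) α := by
  have := ((h.hasDerivAt_moment_right (g := fun _ => 1) continuous_const 1 (-π) α hη).div_const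
    (meanJac β η)).const_add (-π)
  exact this.congr_deriv (by simp)

theorem IsAmplitude.strictMono_flow (h : IsAmplitude β m) {η : ℝ} (hη : η ∈ paramRange m) :
    StrictMono (flow β η) :=
  strictMono_of_deriv_pos fun α => by
    rw [(h.hasDerivAt_flow hη α).deriv]
    exact div_pos (h.jac_pos hη α) (h.meanJac_pos hη)

theorem flow_neg_pi : flow β η (-π) = -π := by simp [flow, moment]

theorem IsAmplitude.flow_pi (h : IsAmplitude β m) {η : ℝ} (hη : η ∈ paramRange m) :
    flow β η π = π := by
  have h1 := h.meanJac_pos hη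
  have h2 : moment β (fun _ => 1) 1 (-π) π η = 2 * π * meanJac β η := by
    rw [meanJac]; field_simp
  rw [flow, h2]
  field_simp
  ring

/-- The Jacobian is at least `1/3` on the whole line, so the flow grows at least linearly. With `β`
defined on all of `ℝ` the flow is a bijection of the line, and its inverse needs no care at `±π`. -/
theorem IsAmplitude.surjective_flow (h : IsAmplitude β m) {η : ℝ} (hη : η ∈ paramRange m) :
    Function.Surjective (flow β η) := by
  have hG := h.meanJac_pos hη
  have hc : Continuous (flow β η) :=
    continuous_iff_continuousAt.2 fun α => (h.hasDerivAt_flow hη α).continuousAt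
  refine hc.surjective ?_ ?_
  · have h1 : Tendsto (fun α : ℝ => -π + (α - -π) / 3 / meanJac β η) atTop atTop :=
      tendsto_atTop_add_const_left _ _
        (((tendsto_atTop_add_const_right _ _ tendsto_id).atTop_div_const
          (by norm_num)).atTop_div_const hG)
    refine tendsto_atTop_mono' _ ?_ h1
    filter_upwards [eventually_ge_atTop (-π)] with α hα
    have := h.moment_le hα hη
    unfold flow
    gcongr
  · have h1 : Tendsto (fun α : ℝ => -π + (α - -π) / 3 / meanJac β η) atBot atBot :=
      tendsto_atBot_add_const_left _ _
        (((tendsto_atBot_add_const_right _ _ tendsto_id).atBot_div_const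
          (by norm_num)).atBot_div_const hG)
    refine tendsto_atBot_mono' _ ?_ h1
    filter_upwards [eventually_le_atBot (-π)] with α hα
    have h2 := h.moment_le hα hη
    have h3 : moment β (fun _ => 1) 1 (-π) α η = - moment β (fun _ => 1) 1 α (-π) η :=
      intervalIntegral.integral_symm _ _
    have h4 : moment β (fun _ => 1) 1 (-π) α η ≤ (α - -π) / 3 := by rw [h3]; linarith
    unfold flow
    gcongr

theorem IsAmplitude.flow_label (h : IsAmplitude β m) {η : ℝ} (hη : η ∈ paramRange m) (x : ℝ) :
    flow β η (label β η x) = x :=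
  Function.rightInverse_invFun (h.surjective_flow hη) x

theorem IsAmplitude.label_flow (h : IsAmplitude β m) {η : ℝ} (hη : η ∈ paramRange m) (α : ℝ) :
    label β η (flow β η α) = α :=
  Function.leftInverse_invFun (h.strictMono_flow hη).injective α

theorem IsAmplitude.label_mem (h : IsAmplitude β m) {η : ℝ} (hη : η ∈ paramRange m) {x : ℝ}
    (hx : x ∈ Om) : label β η x ∈ Om := by
  have hm := h.strictMono_flow hη
  constructor
  · rw [← hm.le_iff_le, h.flow_label hη, flow_neg_pi]; exact hx.1
  · rw [← hm.le_iff_le, h.flow_label hη, h.flow_pi hη]; exact hx.2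

theorem IsAmplitude.label_neg_pi (h : IsAmplitude β m) {η : ℝ} (hη : η ∈ paramRange m) :
    label β η (-π) = -π := by
  conv_lhs => rw [← flow_neg_pi (β := β) (η := η)]
  exact h.label_flow hη _

theorem IsAmplitude.label_pi (h : IsAmplitude β m) {η : ℝ} (hη : η ∈ paramRange m) :
    label β η π = π := by
  conv_lhs => rw [← h.flow_pi hη]
  exact h.label_flow hη _

/-- The label is the root of a strictly increasing function of `α` that varies continuously with
`(η, x)`. -/
theorem IsAmplitude.continuousAt_label (h : IsAmplitude β m) {p : ℝ × ℝ}
    (hp : p.1 ∈ paramRange m) : ContinuousAt (fun p : ℝ × ℝ => label β p.1 p.2) p := by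
  have hev : ∀ᶠ q : ℝ × ℝ in 𝓝 p, q.1 ∈ paramRange m :=
    continuousAt_fst.eventually ((isOpen_paramRange m).mem_nhds hp)
  refine continuousAt_root_of_strictMonoOn (F := fun q α => flow β q.1 α - q.2) (I := univ)
    univ_mem ?_ (by simp) ?_ ?_
  · filter_upwards [hev] with q hq
    exact fun a _ b _ hab => sub_lt_sub_right (h.strictMono_flow hq hab) _
  · filter_upwards [hev] with q hq
    rw [h.flow_label hq, sub_self]
  · intro α _
    have h1 : ContinuousAt (fun s => flow β s α) p.1 :=
      continuousAt_const.add ((h.hasDerivAt_moment_zero (-π) α hp).continuousAt.div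
        (h.hasDerivAt_meanJac hp).continuousAt (h.meanJac_pos hp).ne')
    exact (ContinuousAt.comp (f := Prod.fst) h1 continuousAt_fst).sub continuousAt_snd

theorem IsAmplitude.hasDerivAt_label (h : IsAmplitude β m) {η : ℝ} (hη : η ∈ paramRange m) (x : ℝ) :
    HasDerivAt (label β η) (meanJac β η / jac β η (label β η x)) x := by
  have h1 : ContinuousAt (label β η) x :=
    ContinuousAt.comp (f := fun x : ℝ => ((η, x) : ℝ × ℝ))
      (h.continuousAt_label (p := (η, x)) hη) (by fun_prop)
  have h2 := HasDerivAt.of_local_left_inverse h1 (h.hasDerivAt_flow hη (label β η x))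
    (div_pos (h.jac_pos hη _) (h.meanJac_pos hη)).ne' (Eventually.of_forall (h.flow_label hη))
  rwa [inv_div] at h2

theorem IsAmplitude.moment_label (h : IsAmplitude β m) {η : ℝ} (hη : η ∈ paramRange m) (x : ℝ) :
    moment β (fun _ => 1) 1 (-π) (label β η x) η = (x + π) * meanJac β η := by
  have h1 := h.flow_label hη x
  have h2 := h.meanJac_pos hη
  rw [flow] at h1
  rw [← div_eq_iff h2.ne']
  linarith

/-- The derivative of the label at a fixed position in the parameter `η`. -/
noncomputable def labelSpeed (β : ℝ → ℝ) (η x : ℝ) : ℝ :=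
  ((x + π) * meanJac₁ β η - moment β β 2 (-π) (label β η x) η) / jac β η (label β η x)

/-- Implicit differentiation of `moment_label`, done by hand. The increment of the label times the
mean Jacobian `w` over the interval between the two labels equals `N`, which is differentiable and
vanishes at `η`; dividing by the continuous `w` gives the derivative. -/
theorem IsAmplitude.hasDerivAt_label_param (h : IsAmplitude β m) {η : ℝ} (hη : η ∈ paramRange m)
    (x : ℝ) : HasDerivAt (fun s => label β s x) (labelSpeed β η x) η := by
  set z := label β η x with hz
  have hzc : ContinuousAt (fun s => label β s x) η :=
    ContinuousAt.comp (f := fun s : ℝ => ((s, x) : ℝ × ℝ))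
      (h.continuousAt_label (p := (η, x)) hη) (by fun_prop)
  -- the mean of the Jacobian between the labels at the parameters `η` and `s`
  set w : ℝ → ℝ := fun s => ∫ t in (0 : ℝ)..1, jac β s (z + t * (label β s x - z)) with hw
  have hwη : w η = jac β η z := by simp [hw, ← hz]
  have hev : ∀ᶠ s in 𝓝 η, s ∈ paramRange m := (isOpen_paramRange m).mem_nhds hη
  have hwc : ContinuousAt w η := by
    obtain ⟨d, hd0, hdI⟩ := (nhds_basis_Icc_pos η).mem_iff.1 ((isOpen_paramRange m).mem_nhds hη)
    obtain ⟨C, hC⟩ := (isCompact_Icc.prod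
      (isCompact_Icc (a := z - 1) (b := z + 1))).exists_bound_of_continuousOn
      (h.continuousOn_jac.mono (prod_mono hdI (subset_univ (Icc (z - 1) (z + 1)))))
    have hnear : ∀ᶠ s in 𝓝 η, |label β s x - z| < 1 := by
      have h1 : ContinuousAt (fun s => |label β s x - z|) η := (hzc.sub continuousAt_const).abs
      exact h1.eventually_lt continuousAt_const (by simp [← hz])
    refine intervalIntegral.continuousAt_of_dominated_interval (bound := fun _ => C) ?_ ?_
      (by simp) ?_
    · filter_upwards [hev] with s hs
      exact ((h.continuous_jac hs).comp (by fun_prop)).aestronglyMeasurable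
    · filter_upwards [hnear, Icc_mem_nhds (show η - d < η by linarith) (show η < η + d by linarith)]
        with s hs hs'
      refine Eventually.of_forall fun t ht => hC (s, _) ⟨hs', ?_⟩
      rw [uIoc_of_le zero_le_one] at ht
      have h2 : |t * (label β s x - z)| ≤ 1 := by
        rw [abs_mul, abs_of_pos ht.1]
        nlinarith [ht.1, ht.2, abs_nonneg (label β s x - z)]
      have h3 := abs_le.1 h2
      constructor <;> dsimp only <;> linarith [h3.1, h3.2]
    · refine Eventually.of_forall fun t _ => ?_
      have h1 : ContinuousAt (fun s : ℝ => (s, z + t * (label β s x - z))) η :=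
        continuousAt_id.prodMk (continuousAt_const.add (continuousAt_const.mul
          (hzc.sub continuousAt_const)))
      exact ContinuousAt.comp (f := fun s : ℝ => (s, z + t * (label β s x - z)))
        (g := fun p : ℝ × ℝ => jac β p.1 p.2)
        (h.continuousOn_jac.continuousAt
          (prod_mem_nhds ((isOpen_paramRange m).mem_nhds hη) univ_mem)) h1
  set N : ℝ → ℝ := fun s => (x + π) * meanJac β s - moment β (fun _ => 1) 1 (-π) z s with hN
  have hNη : N η = 0 := by
    have := h.moment_label hη x
    simp only [hN]
    rw [← hz] at this
    rw [this, sub_self]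
  have hNd : HasDerivAt N ((x + π) * meanJac₁ β η - moment β β 2 (-π) z η) η :=
    ((h.hasDerivAt_meanJac hη).const_mul _).sub (h.hasDerivAt_moment_zero (-π) z hη)
  have key : ∀ s ∈ paramRange m, N s = w s * (label β s x - z) := by
    intro s hs
    have hi : ∀ a b : ℝ, IntervalIntegrable (fun α => (1 : ℝ) * jac β s α ^ 1) volume a b :=
      fun a b => (h.continuous_integrand hs continuous_const 1).intervalIntegrable a b
    have h1 : N s = ∫ α in z..label β s x, jac β s α := by
      simp only [hN]
      rw [← h.moment_label hs x, moment, moment,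
        intervalIntegral.integral_interval_sub_left (hi _ _) (hi _ _)]
      simp
    rw [h1]
    simp only [hw]
    have h3 := intervalIntegral.smul_integral_comp_add_mul (f := jac β s) (a := 0) (b := 1)
      (label β s x - z) z
    simp only [smul_eq_mul, mul_zero, add_zero, mul_one, add_sub_cancel] at h3
    rw [← h3, mul_comm]
    simp only [mul_comm]
  have hwpos : 0 < w η := by rw [hwη]; exact h.jac_pos hη z
  have h4 := (HasDerivAt.mul_of_eq_zero hNd hNη (hwc.inv₀ hwpos.ne')).add_const z
  rw [labelSpeed, ← hz, ← hwη, div_eq_mul_inv]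
  refine h4.congr_of_eventuallyEq ?_
  filter_upwards [hev, continuousAt_const.eventually_lt hwc hwpos] with s hs hws
  rw [key s hs]
  simp only [Pi.inv_apply]
  field_simp
  ring

end

/-! ### Spatial derivatives and the equation in the parameter -/

section

variable {β : ℝ → ℝ} {m : ℝ}

/-- The spatial derivatives of the explicit solution. -/
noncomputable def velDeriv (β : ℝ → ℝ) (η : ℝ) : ℕ → ℝ → ℝ
  | 0, x => vel β η x
  | 1, x => iteratedDerivWithin 1 β Om (label β η x) * jac β η (label β η x)
  | 2, x => meanJac β η * (iteratedDerivWithin 2 β Om (label β η x)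
      + η * iteratedDerivWithin 1 β Om (label β η x) ^ 2 * jac β η (label β η x))
  | _, x => meanJac β η ^ 2 * (iteratedDerivWithin 3 β Om (label β η x) / jac β η (label β η x)
      + 2 * η * iteratedDerivWithin 1 β Om (label β η x) * iteratedDerivWithin 2 β Om (label β η x)
      + η ^ 2 * iteratedDerivWithin 1 β Om (label β η x) ^ 3 * jac β η (label β η x))

theorem IsAmplitude.hasDerivWithinAt_comp_label (h : IsAmplitude β m) {η : ℝ}
    (hη : η ∈ paramRange m) {x : ℝ} {g : ℝ → ℝ} {g' : ℝ}
    (hg : HasDerivWithinAt g g' Om (label β η x)) :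
    HasDerivWithinAt (fun y => g (label β η y))
      (g' * (meanJac β η / jac β η (label β η x))) Om x :=
  hg.comp x (h.hasDerivAt_label hη x).hasDerivWithinAt fun _ hy => h.label_mem hη hy

theorem IsAmplitude.hasDerivWithinAt_jac (h : IsAmplitude β m) {η : ℝ} (hη : η ∈ paramRange m)
    {α β' : ℝ} (hβ : HasDerivWithinAt β β' Om α) :
    HasDerivWithinAt (jac β η) (η * β' * jac β η α ^ 2) Om α := by
  have h0 := (h.one_sub_pos hη α).ne'
  refine (((hβ.const_mul η).const_sub 1).inv h0).congr_deriv ?_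
  simp only [jac]
  field_simp

theorem IsAmplitude.hasDerivWithinAt_velDeriv (h : IsAmplitude β m) (hβ : ContDiffOn ℝ 3 β Om)
    {η : ℝ} (hη : η ∈ paramRange m) {j : ℕ} (hj : j < 3) {x : ℝ} (hx : x ∈ Om) :
    HasDerivWithinAt (velDeriv β η j) (velDeriv β η (j + 1) x) Om x := by
  have hz := h.label_mem hη hx
  have hd : ∀ j < 3, HasDerivWithinAt (iteratedDerivWithin j β Om)
      (iteratedDerivWithin (j + 1) β Om (label β η x)) Om (label β η x) :=
    fun j hj => hasDerivWithinAt_iteratedDerivWithin hβ hj hz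
  have h0 := hd 0 (by norm_num)
  rw [iteratedDerivWithin_zero, zero_add] at h0
  have c0 := h.hasDerivWithinAt_comp_label hη h0
  have cU := h.hasDerivWithinAt_comp_label hη (h.hasDerivWithinAt_jac hη h0)
  have c1 := h.hasDerivWithinAt_comp_label hη (hd 1 (by norm_num))
  have c2 := h.hasDerivWithinAt_comp_label hη (hd 2 (by norm_num))
  have hU := (h.jac_pos hη (label β η x)).ne'
  have hG := (h.meanJac_pos hη).ne'
  -- This identity gives `(β J)' = β' J²` in the label. With the label's derivative `G/J` and the
  -- factor `1/G` in `vel`, the first derivative collapses to `β' J`.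
  have hUe : 1 + η * β (label β η x) * jac β η (label β η x) = jac β η (label β η x) := by
    have := (h.one_sub_pos hη (label β η x)).ne'
    simp only [jac]
    field_simp
    ring
  interval_cases j
  · refine (((c0.mul cU).sub_const _).div_const _).congr_deriv ?_
    simp only [velDeriv]
    field_simp
    linear_combination (iteratedDerivWithin 1 β Om (label β η x)) * hUe
  · refine (c1.mul cU).congr_deriv ?_
    simp only [velDeriv]
    field_simp
  · refine ((c2.add ((c1.pow 2).const_mul η |>.mul cU)).const_mul (meanJac β η)).congr_deriv ?_
    simp only [velDeriv]
    field_simp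
    norm_num
    ring

theorem IsAmplitude.continuousOn_velDeriv (h : IsAmplitude β m) (hβ : ContDiffOn ℝ 3 β Om) {j : ℕ}
    (hj : j ≤ 3) :
    ContinuousOn (fun p : ℝ × ℝ => velDeriv β p.1 j p.2) (paramRange m ×ˢ Om) := by
  have hz : ContinuousOn (fun p : ℝ × ℝ => label β p.1 p.2) (paramRange m ×ˢ Om) :=
    fun p hp => (h.continuousAt_label hp.1).continuousWithinAt
  have hf : ∀ j ≤ 3, ContinuousOn
      (fun p : ℝ × ℝ => iteratedDerivWithin j β Om (label β p.1 p.2)) (paramRange m ×ˢ Om) :=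
    fun j hj => (hβ.continuousOn_iteratedDerivWithin (by exact_mod_cast hj) uniqueDiffOn_Om).comp hz
      fun p hp => h.label_mem hp.1 hp.2
  have hU : ContinuousOn (fun p : ℝ × ℝ => jac β p.1 (label β p.1 p.2)) (paramRange m ×ˢ Om) :=
    h.continuousOn_jac.comp (continuousOn_fst.prodMk hz) fun p hp => ⟨hp.1, mem_univ _⟩
  have hU0 : ∀ p ∈ paramRange m ×ˢ Om, jac β p.1 (label β p.1 p.2) ≠ 0 :=
    fun p hp => (h.jac_pos hp.1 _).ne'
  have hG : ContinuousOn (fun p : ℝ × ℝ => meanJac β p.1) (paramRange m ×ˢ Om) :=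
    ContinuousOn.comp (g := meanJac β) (t := paramRange m)
      (fun s hs => (h.hasDerivAt_meanJac hs).continuousAt.continuousWithinAt) continuousOn_fst
      fun p hp => hp.1
  have hG1 : ContinuousOn (fun p : ℝ × ℝ => meanJac₁ β p.1) (paramRange m ×ˢ Om) :=
    ContinuousOn.comp (g := meanJac₁ β) (t := paramRange m)
      (fun s hs => (h.hasDerivAt_meanJac₁ hs).continuousAt.continuousWithinAt) continuousOn_fst
      fun p hp => hp.1
  have hG0 : ∀ p ∈ paramRange m ×ˢ Om, meanJac β p.1 ≠ 0 := fun p hp => (h.meanJac_pos hp.1).ne'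
  have h0 := hf 0 (by norm_num)
  have h1 := hf 1 (by norm_num)
  have h2 := hf 2 (by norm_num)
  have h3 := hf 3 (by norm_num)
  have hη : ContinuousOn (fun p : ℝ × ℝ => p.1) (paramRange m ×ˢ Om) := continuousOn_fst
  simp only [iteratedDerivWithin_zero] at h0
  interval_cases j
  · exact ((h0.mul hU).sub (hG1.div hG hG0)).div hG hG0
  · exact h1.mul hU
  · exact hG.mul (h2.add ((hη.mul (h1.pow 2)).mul hU))
  · exact (hG.pow 2).mul (((h3.div hU hU0).add (((continuousOn_const.mul hη).mul h1).mul h2)).add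
      (((hη.pow 2).mul (h1.pow 3)).mul hU))

theorem IsAmplitude.contDiffOn_vel (h : IsAmplitude β m) (hβ : ContDiffOn ℝ 3 β Om) {η : ℝ}
    (hη : η ∈ paramRange m) :
    ContDiffOn ℝ 3 (vel β η) Om ∧
      ∀ j ≤ 3, EqOn (iteratedDerivWithin j (vel β η) Om) (velDeriv β η j) Om := by
  refine contDiffOn_three_of_hasDerivWithinAt (d := velDeriv β η)
    (fun j hj x hx => h.hasDerivWithinAt_velDeriv hβ hη hj hx) ?_
  exact (h.continuousOn_velDeriv hβ le_rfl).comp (f := fun x : ℝ => ((η, x) : ℝ × ℝ))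
    (by fun_prop) fun x hx => ⟨hη, hx⟩

theorem IsAmplitude.continuous_vel (h : IsAmplitude β m) {η : ℝ} (hη : η ∈ paramRange m) :
    Continuous (vel β η) := by
  have hl : Continuous (label β η) :=
    continuous_iff_continuousAt.2 fun x => (h.hasDerivAt_label hη x).continuousAt
  exact (((h.cont.comp hl).mul ((h.continuous_jac hη).comp hl)).sub continuous_const).div_const _

theorem IsAmplitude.hasDerivAt_moment_label (h : IsAmplitude β m) {η : ℝ} (hη : η ∈ paramRange m)
    {g : ℝ → ℝ} (hg : Continuous g) (n : ℕ) (x : ℝ) :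
    HasDerivAt (fun x => moment β g n (-π) (label β η x) η)
      (g (label β η x) * jac β η (label β η x) ^ n *
        (meanJac β η / jac β η (label β η x))) x :=
  (h.hasDerivAt_moment_right hg n (-π) (label β η x) hη).comp x (h.hasDerivAt_label hη x)

/-- Change of variables `dx = (J/G) dα`, written as an antiderivative. The value is the velocity of
the flow map in physical time. -/
theorem IsAmplitude.integral_vel (h : IsAmplitude β m) {η : ℝ} (hη : η ∈ paramRange m) (x : ℝ) :
    ∫ y in (-π)..x, vel β η y =
      (moment β β 2 (-π) (label β η x) η - meanJac₁ β η * (x + π)) / meanJac β η ^ 2 := by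
  have hG := (h.meanJac_pos hη).ne'
  have hd : ∀ y ∈ uIcc (-π) x, HasDerivAt (fun y =>
      (moment β β 2 (-π) (label β η y) η - meanJac₁ β η * (y + π)) / meanJac β η ^ 2)
      (vel β η y) y := by
    intro y _
    have hU := (h.jac_pos hη (label β η y)).ne'
    refine (((h.hasDerivAt_moment_label hη h.cont 2 y).sub
      (((hasDerivAt_id y).add_const π).const_mul (meanJac₁ β η))).div_const _).congr_deriv ?_
    rw [vel]
    field_simp
  rw [intervalIntegral.integral_eq_sub_of_hasDerivAt hd
    ((h.continuous_vel hη).intervalIntegrable _ _), h.label_neg_pi hη]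
  simp [moment]

theorem IsAmplitude.integral_vel_eq_zero (h : IsAmplitude β m) {η : ℝ} (hη : η ∈ paramRange m) :
    ∫ y in (-π)..π, vel β η y = 0 := by
  have := pi_pos
  rw [h.integral_vel hη, h.label_pi hη, meanJac₁]
  field_simp
  ring

/-- The square is expanded after the substitution `dx = (J/G) dα`, and each term is a moment. The
result is `π` times the physical-time derivative of `G₁/G²`, which is what identifies the memory
term of the equation. -/
theorem IsAmplitude.integral_vel_sq (h : IsAmplitude β m) {η : ℝ} (hη : η ∈ paramRange m) :
    ∫ y in (-π)..π, vel β η y ^ 2 =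
      π * ((meanJac₂ β η - 2 * meanJac₁ β η ^ 2 / meanJac β η) / meanJac β η ^ 3) := by
  have hG := (h.meanJac_pos hη).ne'
  have hβ := h.cont
  have hπ := pi_pos
  have hd : ∀ y ∈ uIcc (-π) π, HasDerivAt (fun y =>
      (moment β (fun α => 2 * (β α * β α)) 3 (-π) (label β η y) η / 2
        - 2 * (meanJac₁ β η / meanJac β η) * moment β β 2 (-π) (label β η y) η
        + (meanJac₁ β η / meanJac β η) ^ 2 * moment β (fun _ => 1) 1 (-π) (label β η y) η)
        / meanJac β η ^ 3)
      (vel β η y ^ 2) y := by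
    intro y _
    have hU := (h.jac_pos hη (label β η y)).ne'
    refine (((((h.hasDerivAt_moment_label hη
      (g := fun α => 2 * (β α * β α)) (by fun_prop) 3 y).div_const 2).sub ((h.hasDerivAt_moment_label hη h.cont 2 y).const_mul _)).add
      ((h.hasDerivAt_moment_label hη (g := fun _ => 1) continuous_const 1 y).const_mul _)).div_const
      _).congr_deriv ?_
    rw [vel]
    field_simp
    ring
  rw [intervalIntegral.integral_eq_sub_of_hasDerivAt hd
    (((h.continuous_vel hη).pow 2).intervalIntegrable _ _), h.label_neg_pi hη, h.label_pi hη]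
  have e0 : moment β (fun _ => 1) 1 (-π) π η = 2 * π * meanJac β η := by
    rw [meanJac]; field_simp
  have e1 : moment β β 2 (-π) π η = 2 * π * meanJac₁ β η := by
    rw [meanJac₁]; field_simp
  have e2 : moment β (fun α => 2 * (β α * β α)) 3 (-π) π η = 2 * π * meanJac₂ β η := by
    rw [meanJac₂]; field_simp
  have e3 : ∀ g : ℝ → ℝ, ∀ n, moment β g n (-π) (-π) η = 0 := fun g n => by simp [moment]
  rw [e0, e1, e2, e3, e3, e3]
  field_simp
  ring

/-- The derivative of the explicit solution in the parameter `η` at a fixed position. -/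
theorem IsAmplitude.hasDerivAt_vel_param (h : IsAmplitude β m) (hβ : ContDiffOn ℝ 3 β Om) {η : ℝ}
    (hη : η ∈ paramRange m) {x : ℝ} (hx : x ∈ Om) :
    HasDerivAt (fun s => vel β s x)
      (meanJac β η * (-(∫ y in (-π)..x, vel β η y) * derivWithin (vel β η) Om x + vel β η x ^ 2
        - (1 / π) * (∫ y in (-π)..π, vel β η y ^ 2)
        + meanJac₁ β η / meanJac β η ^ 2 * vel β η x)) η := by
  have hz := h.label_mem hη hx
  have hev : ∀ᶠ s in 𝓝 η, label β s x ∈ Om := by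
    filter_upwards [(isOpen_paramRange m).mem_nhds hη] with s hs using h.label_mem hs hx
  have h0 := hasDerivWithinAt_iteratedDerivWithin hβ (show 0 < 3 by norm_num) hz
  rw [iteratedDerivWithin_zero, zero_add] at h0
  have hy := h0.comp_hasDerivAt η (h.hasDerivAt_label_param hη x) hev
  have hG := (h.meanJac_pos hη).ne'
  have hw := (h.one_sub_pos hη (label β η x)).ne'
  have hU := (h.jac_pos hη (label β η x)).ne'
  have hUw : jac β η (label β η x) * (1 - η * β (label β η x)) = 1 := inv_mul_cancel₀ hw
  have hJ : HasDerivAt (fun s => jac β s (label β s x)) _ η :=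
    ((((hasDerivAt_id η).mul hy).const_sub 1).inv hw)
  have hR := ((hy.mul hJ).sub ((h.hasDerivAt_meanJac₁ hη).div (h.hasDerivAt_meanJac hη) hG)).div
    (h.hasDerivAt_meanJac hη) hG
  have hdw : derivWithin (vel β η) Om x = velDeriv β η 1 x :=
    (h.hasDerivWithinAt_velDeriv hβ hη (show 0 < 3 by norm_num) hx).derivWithin
      (uniqueDiffOn_Om x hx)
  rw [hdw, h.integral_vel hη, h.integral_vel_sq hη]
  refine hR.congr_deriv ?_
  have hπ := pi_pos.ne'
  simp only [velDeriv, labelSpeed, vel, Function.comp_apply, id]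
  -- From here the claim is a rational identity in the Jacobian `U`, the means `G`, `G1`, `G2`, the
  -- moment `M`, the value `y` and the slope `d`; the relation `hUw` removes `η`.
  have hU2 : (1 - η * β (label β η x)) = (jac β η (label β η x))⁻¹ := by simp [jac]
  simp only [Pi.div_apply, Pi.mul_apply, Function.comp_apply, id, Pi.sub_apply] at *
  rw [hU2]
  generalize jac β η (label β η x) = U at *
  generalize β (label β η x) = y at *
  generalize moment β β 2 (-π) (label β η x) η = M at *
  generalize meanJac β η = G at *
  generalize meanJac₁ β η = G1 at *
  generalize meanJac₂ β η = G2 at *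
  generalize iteratedDerivWithin 1 β Om (label β η x) = d at *
  clear hR hJ hy h0
  field_simp
  linear_combination (-(d * ((x + π) * G1 - M) * G ^ 2)) * hUw

/-! ### Physical time and verification of the equation -/

theorem IsAmplitude.hasDerivAt_physTime (h : IsAmplitude β m) {η : ℝ} (hη : η ∈ paramRange m) :
    HasDerivAt (physTime β) (meanJac β η) η := by
  have hc : ContinuousOn (meanJac β) (paramRange m) :=
    fun s hs => (h.hasDerivAt_meanJac hs).continuousAt.continuousWithinAt
  have hs : uIcc 0 η ⊆ paramRange m :=
    OrdConnected.uIcc_subset (by unfold paramRange; infer_instance) h.zero_mem hη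
  exact intervalIntegral.integral_hasDerivAt_right (hc.mono hs).intervalIntegrable
    (hc.stronglyMeasurableAtFilter (isOpen_paramRange m) η hη)
    (h.hasDerivAt_meanJac hη).continuousAt

theorem IsAmplitude.strictMonoOn_physTime (h : IsAmplitude β m) :
    StrictMonoOn (physTime β) (paramRange m) := by
  refine strictMonoOn_of_deriv_pos (convex_Ioo _ _)
    (fun s hs => (h.hasDerivAt_physTime hs).continuousAt.continuousWithinAt) fun s hs => ?_
  have hs' := interior_subset hs
  rw [(h.hasDerivAt_physTime hs').deriv]
  exact h.meanJac_pos hs'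

/-- The parameter `η` as a function of physical time. -/
noncomputable def param (β : ℝ → ℝ) (m τ : ℝ) : ℝ :=
  Function.invFunOn (physTime β) (paramRange m) τ

theorem param_mem {τ : ℝ} (hτ : τ ∈ physTime β '' paramRange m) : param β m τ ∈ paramRange m :=
  Function.invFunOn_mem hτ

theorem physTime_param {τ : ℝ} (hτ : τ ∈ physTime β '' paramRange m) :
    physTime β (param β m τ) = τ :=
  Function.invFunOn_eq hτ

theorem IsAmplitude.param_physTime (h : IsAmplitude β m) {η : ℝ} (hη : η ∈ paramRange m) :
    param β m (physTime β η) = η :=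
  h.strictMonoOn_physTime.injOn (param_mem (mem_image_of_mem _ hη)) hη
    (physTime_param (mem_image_of_mem _ hη))

theorem IsAmplitude.isOpen_image_physTime (h : IsAmplitude β m) :
    IsOpen (physTime β '' paramRange m) := by
  rw [isOpen_iff_mem_nhds]
  rintro _ ⟨η, hη, rfl⟩
  obtain ⟨d, hd0, hdI⟩ := (nhds_basis_Icc_pos η).mem_iff.1 ((isOpen_paramRange m).mem_nhds hη)
  have h1 : η - d ∈ paramRange m := hdI ⟨le_rfl, by linarith⟩
  have h2 : η + d ∈ paramRange m := hdI ⟨by linarith, le_rfl⟩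
  have h3 := intermediate_value_Icc (show η - d ≤ η + d by linarith) (f := physTime β)
    fun s hs => (h.hasDerivAt_physTime (hdI hs)).continuousAt.continuousWithinAt
  exact mem_of_superset (Icc_mem_nhds (h.strictMonoOn_physTime h1 hη (by linarith))
    (h.strictMonoOn_physTime hη h2 (by linarith))) (h3.trans (image_mono hdI))

theorem IsAmplitude.hasDerivAt_param (h : IsAmplitude β m) {τ : ℝ}
    (hτ : τ ∈ physTime β '' paramRange m) :
    HasDerivAt (param β m) (meanJac β (param β m τ))⁻¹ τ := by
  have hη := param_mem hτ
  have hJ := h.isOpen_image_physTime.mem_nhds hτ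
  have hc : ContinuousAt (param β m) τ := by
    refine continuousAt_root_of_strictMonoOn (F := fun t η => physTime β η - t)
      (I := paramRange m) ((isOpen_paramRange m).mem_nhds hη)
      (Eventually.of_forall fun t a ha b hb hab =>
        sub_lt_sub_right (h.strictMonoOn_physTime ha hb hab) _)
      ?_ ?_ fun α _ => by fun_prop
    · filter_upwards [hJ] with t ht using param_mem ht
    · filter_upwards [hJ] with t ht
      rw [physTime_param ht, sub_self]
  refine HasDerivAt.of_local_left_inverse hc (h.hasDerivAt_physTime hη) (h.meanJac_pos hη).ne' ?_
  filter_upwards [hJ] with t ht using physTime_param ht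

theorem IsAmplitude.param_zero (h : IsAmplitude β m) : param β m 0 = 0 := by
  have := h.param_physTime h.zero_mem
  rwa [show physTime β 0 = 0 by simp [physTime]] at this

theorem meanJac_zero : meanJac β 0 = 1 := by
  have := pi_pos
  simp [meanJac, moment, jac]
  field_simp
  norm_num

theorem meanJac₁_zero (hmean : ∫ y in (-π)..π, β y = 0) : meanJac₁ β 0 = 0 := by
  simp [meanJac₁, moment, jac, hmean]

theorem IsAmplitude.label_zero (h : IsAmplitude β m) (x : ℝ) : label β 0 x = x := by
  have h1 : flow β 0 x = x := by simp [flow, meanJac_zero]; simp [moment, jac]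
  conv_lhs => rw [← h1]
  exact h.label_flow h.zero_mem x

/-- The equation in `η` becomes the one in `τ` by `dη/dτ = 1/G`, once `G₁/G²` is recognised as the
time-integrated energy. -/
theorem IsAmplitude.isC3Solution (h : IsAmplitude β m) (hβ : ContDiffOn ℝ 3 β Om)
    (hmean : ∫ y in (-π)..π, β y = 0) {T : ℝ} (hT : Ico 0 T ⊆ physTime β '' paramRange m) :
    IsC3Solution β T fun τ x => vel β (param β m τ) x := by
  have hη : ∀ τ ∈ Ico 0 T, param β m τ ∈ paramRange m := fun τ hτ => param_mem (hT hτ)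
  -- Both sides have the same derivative in `τ` and vanish at `τ = 0`, where `G₁` is the mean of the
  -- datum.
  have henergy : ∀ τ ∈ Ico 0 T,
      (1 / π) * ∫ s in (0 : ℝ)..τ, ∫ y in (-π)..π, vel β (param β m s) y ^ 2
        = meanJac₁ β (param β m τ) / meanJac β (param β m τ) ^ 2 := by
    intro τ hτ
    have hsub : uIcc 0 τ ⊆ Ico 0 T := by
      rw [uIcc_of_le hτ.1]
      exact fun s hs => ⟨hs.1, hs.2.trans_lt hτ.2⟩
    have hd : ∀ s ∈ uIcc 0 τ, HasDerivAt
        (fun s => π * (meanJac₁ β (param β m s) / meanJac β (param β m s) ^ 2))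
        (∫ y in (-π)..π, vel β (param β m s) y ^ 2) s := by
      intro s hs
      have hs' := hη s (hsub hs)
      have hG := (h.meanJac_pos hs').ne'
      rw [h.integral_vel_sq hs']
      refine (((((h.hasDerivAt_meanJac₁ hs').div ((h.hasDerivAt_meanJac hs').pow 2)
        (pow_ne_zero 2 hG)).comp s (h.hasDerivAt_param (hT (hsub hs))))).const_mul π).congr_deriv ?_
      simp only [Pi.pow_apply]
      field_simp
      norm_num
      ring
    have hcont : ContinuousOn (fun s => ∫ y in (-π)..π, vel β (param β m s) y ^ 2) (uIcc 0 τ) := by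
      refine ContinuousOn.congr (f := fun s => π * ((meanJac₂ β (param β m s)
        - 2 * meanJac₁ β (param β m s) ^ 2 / meanJac β (param β m s))
        / meanJac β (param β m s) ^ 3)) ?_ fun s hs => h.integral_vel_sq (hη s (hsub hs))
      intro s hs
      have hs' := hη s (hsub hs)
      have hG := (h.meanJac_pos hs').ne'
      have c := (h.hasDerivAt_param (hT (hsub hs))).continuousAt
      have c0 := ContinuousAt.comp (f := param β m) (h.hasDerivAt_meanJac hs').continuousAt c
      have c1 := ContinuousAt.comp (f := param β m) (h.hasDerivAt_meanJac₁ hs').continuousAt c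
      have c2 := ContinuousAt.comp (f := param β m) (h.continuousAt_meanJac₂ hs') c
      exact (continuousAt_const.mul ((c2.sub ((continuousAt_const.mul (c1.pow 2)).div c0 hG)).div
        (c0.pow 3) (pow_ne_zero 3 hG))).continuousWithinAt
    rw [intervalIntegral.integral_eq_sub_of_hasDerivAt hd hcont.intervalIntegrable, h.param_zero,
      meanJac₁_zero hmean]
    have := pi_pos
    field_simp
    simp
  constructor
  · exact fun τ hτ => (h.contDiffOn_vel hβ (hη τ hτ)).1
  · intro j hj
    have hmaps : MapsTo (fun p : ℝ × ℝ => ((param β m p.1, p.2) : ℝ × ℝ)) (Ico 0 T ×ˢ Om)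
        (paramRange m ×ˢ Om) := fun p hp => ⟨hη _ hp.1, hp.2⟩
    have hc : ContinuousOn (fun p : ℝ × ℝ => ((param β m p.1, p.2) : ℝ × ℝ)) (Ico 0 T ×ˢ Om) :=
      (ContinuousOn.comp (g := param β m) (t := Ico 0 T)
        (fun τ hτ => (h.hasDerivAt_param (hT hτ)).continuousAt.continuousWithinAt)
        continuousOn_fst fun p hp => hp.1).prodMk continuousOn_snd
    exact ((h.continuousOn_velDeriv hβ hj).comp hc hmaps).congr fun p hp =>
      (h.contDiffOn_vel hβ (hη _ hp.1)).2 j hj hp.2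
  · intro x _
    rw [h.param_zero, vel, h.label_zero, meanJac₁_zero hmean, meanJac_zero]
    simp [jac]
  · intro τ hτ x hx
    have hs' := hη τ hτ
    have hG := (h.meanJac_pos hs').ne'
    have hd := (h.hasDerivAt_vel_param hβ hs' hx).comp τ (h.hasDerivAt_param (hT hτ))
    refine (hd.congr_deriv ?_).hasDerivWithinAt
    rw [rhs, henergy τ hτ]
    field_simp

end

/-! ### Uniqueness by an energy estimate -/

/-- The right-hand side of the evolution equation, with a prescribed space derivative `v`. -/
noncomputable def rate (u v : ℝ → ℝ → ℝ) (τ x : ℝ) : ℝ :=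
  -(∫ y in (-π)..x, u τ y) * v τ x + u τ x ^ 2 - (1 / π) * (∫ y in (-π)..π, u τ y ^ 2)
    + (1 / π) * (∫ s in (0 : ℝ)..τ, ∫ y in (-π)..π, u s y ^ 2) * u τ x

/-- Solutions of the equation on `[0, T] × [-π, π]` that are extended continuously to the plane,
with space derivative `v`. -/
structure IsEvolution (T : ℝ) (u v : ℝ → ℝ → ℝ) : Prop where
  cont : Continuous fun p : ℝ × ℝ => u p.1 p.2
  cont_deriv : Continuous fun p : ℝ × ℝ => v p.1 p.2
  space : ∀ τ ∈ Icc 0 T, ∀ x ∈ Om, HasDerivWithinAt (u τ) (v τ x) Om x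
  time : ∀ τ ∈ Ioo 0 T, ∀ x ∈ Om, HasDerivAt (fun s => u s x) (rate u v τ x) τ

/-- The projection of the line to `[a, b]`. -/
noncomputable def clamp (a b x : ℝ) : ℝ := max a (min b x)

theorem continuous_clamp (a b : ℝ) : Continuous (clamp a b) := by
  unfold clamp; fun_prop

theorem clamp_mem {a b : ℝ} (hab : a ≤ b) (x : ℝ) : clamp a b x ∈ Icc a b :=
  ⟨le_max_left _ _, max_le hab (min_le_left _ _)⟩

theorem clamp_of_mem {a b x : ℝ} (hx : x ∈ Icc a b) : clamp a b x = x := by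
  rw [clamp, min_eq_right hx.2, max_eq_right hx.1]

theorem clamp_mem_Om (x : ℝ) : clamp (-π) π x ∈ Om := clamp_mem (by linarith [pi_pos]) x

/-- Cauchy–Schwarz against the constant one, read off from the nonnegative integral of `(2π|f| -
N)²`. -/
theorem sq_integral_abs_le {f : ℝ → ℝ} (hf : Continuous f) :
    (∫ x in (-π)..π, |f x|) ^ 2 ≤ 2 * π * ∫ x in (-π)..π, f x ^ 2 := by
  have hπ := pi_pos
  set N := ∫ x in (-π)..π, |f x|
  have h0 : 0 ≤ ∫ x in (-π)..π, (2 * π * |f x| - N) ^ 2 :=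
    intervalIntegral.integral_nonneg (by linarith) fun _ _ => sq_nonneg _
  have h1 : ∫ x in (-π)..π, (2 * π * |f x| - N) ^ 2
      = (2 * π) ^ 2 * (∫ x in (-π)..π, f x ^ 2) - 2 * (2 * π) * N * N + (2 * π) * N ^ 2 := by
    have h2 : ∀ x, (2 * π * |f x| - N) ^ 2
        = (2 * π) ^ 2 * f x ^ 2 - 2 * (2 * π) * N * |f x| + N ^ 2 := fun x => by
      rw [← sq_abs (f x)]; ring
    simp only [h2]
    rw [intervalIntegral.integral_add, intervalIntegral.integral_sub,
      intervalIntegral.integral_const_mul, intervalIntegral.integral_const_mul,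
      intervalIntegral.integral_const, smul_eq_mul]
    · ring
    all_goals exact Continuous.intervalIntegrable (by fun_prop) _ _
  rw [h1] at h0
  nlinarith

/-- Grönwall: `exp(-K t) Q t` is antitone and starts at zero. -/
theorem nonpos_of_deriv_le_mul {Q Q' : ℝ → ℝ} {T K : ℝ} (hc : ContinuousOn Q (Icc 0 T))
    (h0 : Q 0 = 0) (hd : ∀ τ ∈ Ioo 0 T, HasDerivAt Q (Q' τ) τ)
    (hle : ∀ τ ∈ Ioo 0 T, Q' τ ≤ K * Q τ) {τ : ℝ} (hτ : τ ∈ Icc 0 T) : Q τ ≤ 0 := by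
  have hanti : AntitoneOn (fun t => exp (-K * t) * Q t) (Icc 0 T) := by
    refine antitoneOn_of_hasDerivWithinAt_nonpos (convex_Icc 0 T)
      (f' := fun t => exp (-K * t) * (Q' t - K * Q t)) (ContinuousOn.mul (by fun_prop) hc) ?_ ?_
    · rw [interior_Icc]
      intro t ht
      have he : HasDerivAt (fun t => exp (-K * t)) (exp (-K * t) * (-K)) t := by
        simpa using ((hasDerivAt_id t).const_mul (-K)).exp
      refine ((he.mul (hd t ht)).congr_deriv ?_).hasDerivWithinAt
      ring
    · rw [interior_Icc]
      intro t ht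
      exact mul_nonpos_of_nonneg_of_nonpos (exp_pos _).le (by linarith [hle t ht])
  have h1 := hanti ⟨le_rfl, hτ.1.trans hτ.2⟩ hτ hτ.1
  simp only [h0, mul_zero] at h1
  by_contra! h
  linarith [mul_pos (exp_pos (-K * τ)) h]

theorem IsEvolution.continuous_rate {T : ℝ} {u v : ℝ → ℝ → ℝ} (h : IsEvolution T u v) :
    Continuous fun p : ℝ × ℝ => rate u v p.1 p.2 := by
  have h1 := h.cont
  have h2 := h.cont_deriv
  have h3 : Continuous fun p : ℝ × ℝ => ∫ y in (-π)..p.2, u p.1 y :=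
    intervalIntegral.continuous_parametric_intervalIntegral_of_continuous
      (f := fun (p : ℝ × ℝ) y => u p.1 y) (by fun_prop) continuous_snd
  have h4 : Continuous fun s : ℝ => ∫ y in (-π)..π, u s y ^ 2 :=
    intervalIntegral.continuous_parametric_intervalIntegral_of_continuous'
      (f := fun s y => u s y ^ 2) (by fun_prop) _ _
  have h5 : Continuous fun τ : ℝ => ∫ s in (0 : ℝ)..τ, ∫ y in (-π)..π, u s y ^ 2 :=
    intervalIntegral.continuous_primitive (fun a b => h4.intervalIntegrable a b) 0
  unfold rate
  fun_prop

/-- Pointwise form of the energy inequality. The added terms `u₂ d² + 2 B d w` are the derivative of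
`B d²`, with `B` the primitive of `u₂`; they cancel the transport term containing `w`, the
difference of the space derivatives, for which no bound in terms of `d` exists. In `7 * M`, five
come from the `u₁` and `u₂` terms and two from Young's inequality. -/
theorem energy_density_le {A B c d e E M N C u₁ u₂ v w : ℝ} (hM : 0 ≤ M) (hu₁ : |u₁| ≤ M)
    (hu₂ : |u₂| ≤ M) (hv : |v| ≤ M) (hA : |A| ≤ N) (hc : |c| ≤ M * N) (hE : |E| ≤ C) :
    2 * d * (-A * v - B * w + (u₁ + u₂) * d - c + e * u₁ + E * d)
      + (u₂ * d ^ 2 + B * (2 * d * w))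
      ≤ (7 * M + 1 + 2 * C) * d ^ 2 + ((M + M ^ 2) * N ^ 2 + M * e ^ 2) := by
  have hN : 0 ≤ N := (abs_nonneg A).trans hA
  have amgm : ∀ p q r : ℝ, |r| ≤ M → 2 * p * q * r ≤ M * (p ^ 2 + q ^ 2) := by
    intro p q r hr
    have h1 := abs_le.1 hr
    nlinarith [mul_nonneg (sub_nonneg.2 h1.2) (sq_nonneg (p + q)),
      mul_nonneg (sub_nonneg.2 h1.1) (sq_nonneg (p - q)), mul_nonneg hM (sq_nonneg (p - q)),
      mul_nonneg hM (sq_nonneg (p + q))]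
  have q1 := amgm d (-A) v hv
  have q2 : u₂ * d ^ 2 ≤ M * d ^ 2 := mul_le_mul_of_nonneg_right (le_of_abs_le hu₂) (sq_nonneg _)
  have q3 : u₁ * d ^ 2 ≤ M * d ^ 2 := mul_le_mul_of_nonneg_right (le_of_abs_le hu₁) (sq_nonneg _)
  have q4 : c ^ 2 ≤ (M * N) ^ 2 := sq_le_sq' (neg_le_of_abs_le hc) (le_of_abs_le hc)
  have q5 := amgm d e u₁ hu₁
  have q6 : E * d ^ 2 ≤ C * d ^ 2 := mul_le_mul_of_nonneg_right (le_of_abs_le hE) (sq_nonneg _)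
  have q7 : A ^ 2 ≤ N ^ 2 := sq_le_sq' (neg_le_of_abs_le hA) (le_of_abs_le hA)
  have q8 := mul_le_mul_of_nonneg_left q7 hM
  have q9 := sq_nonneg (d + c)
  have q10 : 0 ≤ M * d ^ 2 := by positivity
  linarith

set_option maxHeartbeats 600000 in
/-- Two solutions with the same initial datum coincide if one of them is mean-free. -/
theorem IsEvolution.eqOn {T : ℝ} {u₁ v₁ u₂ v₂ : ℝ → ℝ → ℝ} (h₁ : IsEvolution T u₁ v₁)
    (h₂ : IsEvolution T u₂ v₂) (h0 : ∀ x ∈ Om, u₁ 0 x = u₂ 0 x)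
    (hmean : ∀ τ ∈ Icc 0 T, ∫ y in (-π)..π, u₂ τ y = 0) {τ x : ℝ} (hτ : τ ∈ Icc 0 T)
    (hx : x ∈ Om) : u₁ τ x = u₂ τ x := by
  have hπ := pi_pos
  have c1 := h₁.cont
  have c2 := h₂.cont
  have cv1 := h₁.cont_deriv
  have cv2 := h₂.cont_deriv
  set d : ℝ → ℝ → ℝ := fun s y => u₁ s y - u₂ s y with hd
  have cd : Continuous fun p : ℝ × ℝ => d p.1 p.2 := c1.sub c2
  set E₁ : ℝ → ℝ := fun t => (1 / π) * ∫ s in (0 : ℝ)..t, ∫ y in (-π)..π, u₁ s y ^ 2 with hE1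
  set E₂ : ℝ → ℝ := fun t => (1 / π) * ∫ s in (0 : ℝ)..t, ∫ y in (-π)..π, u₂ s y ^ 2 with hE2
  set c : ℝ → ℝ := fun t => (1 / π) * ∫ y in (-π)..π, (u₁ t y + u₂ t y) * d t y with hc
  set N : ℝ → ℝ := fun t => ∫ y in (-π)..π, |d t y| with hN
  set D : ℝ → ℝ := fun t => ∫ y in (-π)..π, d t y ^ 2 with hD
  have csq : ∀ u : ℝ → ℝ → ℝ, Continuous (fun p : ℝ × ℝ => u p.1 p.2) →
      Continuous fun s : ℝ => ∫ y in (-π)..π, u s y ^ 2 := fun u hu =>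
    intervalIntegral.continuous_parametric_intervalIntegral_of_continuous'
      (f := fun s y => u s y ^ 2) (by fun_prop) _ _
  have dE : ∀ u : ℝ → ℝ → ℝ, Continuous (fun p : ℝ × ℝ => u p.1 p.2) → ∀ t,
      HasDerivAt (fun t => (1 / π) * ∫ s in (0 : ℝ)..t, ∫ y in (-π)..π, u s y ^ 2)
        ((1 / π) * ∫ y in (-π)..π, u t y ^ 2) t := fun u hu t =>
    ((csq u hu).integral_hasStrictDerivAt 0 t).hasDerivAt.const_mul _
  have cont_at : ∀ u : ℝ → ℝ → ℝ, Continuous (fun p : ℝ × ℝ => u p.1 p.2) → ∀ t,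
      Continuous (u t) := fun u hu t =>
    hu.comp (f := fun y : ℝ => ((t, y) : ℝ × ℝ)) (by fun_prop)
  have hsub : ∀ t, (1 / π) * (∫ y in (-π)..π, u₁ t y ^ 2) - (1 / π) * (∫ y in (-π)..π, u₂ t y ^ 2)
      = c t := by
    intro t
    have i1 := cont_at u₁ c1 t
    have i2 := cont_at u₂ c2 t
    rw [← mul_sub, ← intervalIntegral.integral_sub]
    · simp only [hc, hd]
      congr 2
      ext y
      ring
    all_goals exact Continuous.intervalIntegrable (by fun_prop) _ _
  -- a common bound
  obtain ⟨M, hM0, hM⟩ : ∃ M : ℝ, 0 ≤ M ∧ ∀ t ∈ Icc 0 T, ∀ y ∈ Om,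
      |u₁ t y| ≤ M ∧ |u₂ t y| ≤ M ∧ |v₁ t y| ≤ M := by
    have hK : IsCompact (Icc 0 T ×ˢ Om) := isCompact_Icc.prod isCompact_Icc
    obtain ⟨M, hM⟩ := hK.exists_bound_of_continuousOn
      (f := fun p : ℝ × ℝ => |u₁ p.1 p.2| + |u₂ p.1 p.2| + |v₁ p.1 p.2|)
      (by fun_prop)
    refine ⟨max M 0, le_max_right _ _, fun t ht y hy => ?_⟩
    have h := (le_abs_self _).trans (hM (t, y) ⟨ht, hy⟩)
    simp only at h
    have a1 := abs_nonneg (u₁ t y)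
    have a2 := abs_nonneg (u₂ t y)
    have a3 := abs_nonneg (v₁ t y)
    refine ⟨?_, ?_, ?_⟩ <;> refine le_trans ?_ (le_max_left M 0) <;> linarith
  have hT0 : 0 ≤ T := hτ.1.trans hτ.2
  have hle : -π ≤ π := by linarith
  have hND : ∀ t, N t ^ 2 ≤ 2 * π * D t := fun t => sq_integral_abs_le (cont_at d cd t)
  have hN0 : ∀ t, 0 ≤ N t := fun t => intervalIntegral.integral_nonneg hle fun _ _ => abs_nonneg _
  have hcN : ∀ t ∈ Icc 0 T, |c t| ≤ M * N t := by
    intro t ht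
    have i := cont_at d cd t
    have i1 := cont_at u₁ c1 t
    have i2 := cont_at u₂ c2 t
    have h1 : |∫ y in (-π)..π, (u₁ t y + u₂ t y) * d t y| ≤ ∫ y in (-π)..π, 2 * M * |d t y| := by
      refine (intervalIntegral.abs_integral_le_integral_abs hle).trans ?_
      refine intervalIntegral.integral_mono_on hle (Continuous.intervalIntegrable (by fun_prop) _ _)
        (Continuous.intervalIntegrable (by fun_prop) _ _) fun y hy => ?_
      rw [abs_mul]
      refine mul_le_mul_of_nonneg_right ?_ (abs_nonneg _)
      have := hM t ht y hy
      exact (abs_add_le _ _).trans (by linarith [this.1, this.2.1])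
    rw [intervalIntegral.integral_const_mul] at h1
    simp only [hc]
    rw [abs_mul, abs_of_pos (by positivity : (0 : ℝ) < 1 / π), one_div, inv_mul_le_iff₀ hπ]
    refine h1.trans ?_
    have := mul_nonneg hM0 (hN0 t)
    have h3 := Real.two_le_pi
    simp only [hN] at this ⊢
    nlinarith
  have hE2b : ∀ t ∈ Icc 0 T, |E₂ t| ≤ 2 * T * M ^ 2 := by
    intro t ht
    have h1 : ∀ s ∈ uIoc 0 t, ‖∫ y in (-π)..π, u₂ s y ^ 2‖ ≤ 2 * π * M ^ 2 := by
      intro s hs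
      rw [uIoc_of_le ht.1] at hs
      have h2 : ∀ y ∈ uIoc (-π) π, ‖u₂ s y ^ 2‖ ≤ M ^ 2 := by
        intro y hy
        rw [uIoc_of_le hle] at hy
        rw [norm_eq_abs, abs_pow]
        exact pow_le_pow_left₀ (abs_nonneg _)
          (hM s ⟨hs.1.le, hs.2.trans ht.2⟩ y ⟨hy.1.le, hy.2⟩).2.1 2
      have := intervalIntegral.norm_integral_le_of_norm_le_const h2
      rw [abs_of_nonneg (by linarith)] at this
      linarith
    have h3 := intervalIntegral.norm_integral_le_of_norm_le_const h1
    rw [sub_zero, abs_of_nonneg ht.1, norm_eq_abs] at h3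
    simp only [hE2]
    rw [abs_mul, abs_of_pos (by positivity : (0 : ℝ) < 1 / π), one_div, inv_mul_le_iff₀ hπ]
    have : 0 ≤ M ^ 2 := sq_nonneg M
    nlinarith [mul_le_mul_of_nonneg_left ht.2 (mul_nonneg hπ.le this)]
  -- the derivative of the energy
  have dD : ∀ t ∈ Ioo 0 T, HasDerivAt D
      (∫ y in (-π)..π, 2 * d t y * (rate u₁ v₁ t y - rate u₂ v₂ t y)) t := by
    intro t ht
    have cr1 := h₁.continuous_rate
    have cr2 := h₂.continuous_rate
    have cc := continuous_clamp (-π) π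
    -- The equation is known only for positions in `Om`; clamping the variable makes the
    -- differentiated integrand valid for every real `y` without changing the integral.
    have key := hasDerivAt_integral_of_continuousOn isOpen_Ioo
      (F := fun s y => d s (clamp (-π) π y) ^ 2)
      (F' := fun s y => 2 * d s (clamp (-π) π y) *
        (rate u₁ v₁ s (clamp (-π) π y) - rate u₂ v₂ s (clamp (-π) π y)))
      (I := Ioo 0 T) (fun s _ => ((cont_at d cd s).comp cc).pow 2)
      (Continuous.continuousOn (by fun_prop)) (fun s hs y => by
        have hy := clamp_mem_Om y
        refine (((h₁.time s hs _ hy).sub (h₂.time s hs _ hy)).pow 2).congr_deriv ?_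
        simp [hd]) (-π) π ht
    have e1 : ∀ s, ∫ y in (-π)..π, d s (clamp (-π) π y) ^ 2 = D s := fun s =>
      intervalIntegral.integral_congr fun y hy => by
        rw [uIcc_of_le hle] at hy
        simp only [clamp_of_mem hy]
    have e2 : ∫ y in (-π)..π, 2 * d t (clamp (-π) π y) *
        (rate u₁ v₁ t (clamp (-π) π y) - rate u₂ v₂ t (clamp (-π) π y))
        = ∫ y in (-π)..π, 2 * d t y * (rate u₁ v₁ t y - rate u₂ v₂ t y) :=
      intervalIntegral.integral_congr fun y hy => by
        rw [uIcc_of_le hle] at hy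
        simp only [clamp_of_mem hy]
    rw [← e2]
    exact key.congr_of_eventuallyEq (Eventually.of_forall fun s => (e1 s).symm)
  set a : ℝ := 7 * M + 1 + 2 * (2 * T * M ^ 2)
  set b : ℝ := M + M ^ 2
  have hJ : ∀ t ∈ Ioo 0 T, ∫ y in (-π)..π, 2 * d t y * (rate u₁ v₁ t y - rate u₂ v₂ t y)
      ≤ a * D t + 2 * π * (b * N t ^ 2 + M * (E₁ t - E₂ t) ^ 2) := by
    intro t ht
    have ht' := Ioo_subset_Icc_self ht
    have i := cont_at d cd t
    have i1 := cont_at u₁ c1 t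
    have i2 := cont_at u₂ c2 t
    have j1 := cont_at v₁ cv1 t
    have j2 := cont_at v₂ cv2 t
    have r1 := cont_at _ h₁.continuous_rate t
    have r2 := cont_at _ h₂.continuous_rate t
    have cA : Continuous fun y => ∫ z in (-π)..y, u₂ t z :=
      intervalIntegral.continuous_primitive (fun _ _ => i2.intervalIntegrable _ _) _
    -- Here alone the mean-free condition enters: the boundary term `(∫ u₂) d²` at `π` vanishes
    -- because `u₂` has mean zero.
    have htr : ∫ y in (-π)..π, (u₂ t y * d t y ^ 2
        + (∫ z in (-π)..y, u₂ t z) * (2 * d t y * (v₁ t y - v₂ t y))) = 0 := by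
      rw [intervalIntegral.integral_eq_sub_of_hasDerivAt_of_le hle
        (f := fun y => (∫ z in (-π)..y, u₂ t z) * d t y ^ 2)]
      · simp [hmean t ht']
      · fun_prop
      · intro y hy
        have hyn : Om ∈ 𝓝 y := Icc_mem_nhds hy.1 hy.2
        have hyO : y ∈ Om := Ioo_subset_Icc_self hy
        refine ((i2.integral_hasStrictDerivAt (-π) y).hasDerivAt.mul
          ((((h₁.space t ht' y hyO).hasDerivAt hyn).sub
          ((h₂.space t ht' y hyO).hasDerivAt hyn)).pow 2)).congr_deriv ?_
        simp [hd]
      · exact Continuous.intervalIntegrable (by fun_prop) _ _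
    have hpt : ∀ y ∈ Icc (-π) π, 2 * d t y * (rate u₁ v₁ t y - rate u₂ v₂ t y)
        + (u₂ t y * d t y ^ 2
          + (∫ z in (-π)..y, u₂ t z) * (2 * d t y * (v₁ t y - v₂ t y)))
        ≤ a * d t y ^ 2 + (b * N t ^ 2 + M * (E₁ t - E₂ t) ^ 2) := by
      intro y hy
      obtain ⟨m1, m2, m3⟩ := hM t ht' y hy
      have hA : |∫ z in (-π)..y, d t z| ≤ N t := by
        refine (intervalIntegral.abs_integral_le_integral_abs hy.1).trans ?_
        exact intervalIntegral.integral_mono_interval le_rfl hy.1 hy.2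
          (Eventually.of_forall fun _ => abs_nonneg _) (i.abs.intervalIntegrable _ _)
      have hAe : ∫ z in (-π)..y, d t z = (∫ z in (-π)..y, u₁ t z) - ∫ z in (-π)..y, u₂ t z :=
        intervalIntegral.integral_sub (i1.intervalIntegrable _ _) (i2.intervalIntegrable _ _)
      have hce := hsub t
      have hcb := hcN t ht'
      have hEb := hE2b t ht'
      have hr : rate u₁ v₁ t y - rate u₂ v₂ t y = -(∫ z in (-π)..y, d t z) * v₁ t y
          - (∫ z in (-π)..y, u₂ t z) * (v₁ t y - v₂ t y) + (u₁ t y + u₂ t y) * d t y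
          - c t + (E₁ t - E₂ t) * u₁ t y + E₂ t * d t y := by
        rw [hAe, ← hce]
        simp only [rate, hd, hE1, hE2]
        ring
      rw [hr]
      generalize (∫ z in (-π)..y, u₂ t z) = B at *
      generalize (∫ z in (-π)..y, d t z) = A at *
      have key := energy_density_le (w := v₁ t y - v₂ t y) (B := B) (e := E₁ t - E₂ t) (d := d t y)
        hM0 m1 m2 m3 hA hcb hEb
      simp only [a, b]
      linarith
    have hint := intervalIntegral.integral_mono_on (μ := volume) hle
      (Continuous.intervalIntegrable (by fun_prop) _ _)
      (Continuous.intervalIntegrable (by fun_prop) _ _) hpt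
    rw [intervalIntegral.integral_add (Continuous.intervalIntegrable (by fun_prop) _ _)
      (Continuous.intervalIntegrable (by fun_prop) _ _), htr, add_zero,
      intervalIntegral.integral_add (Continuous.intervalIntegrable (by fun_prop) _ _)
      (Continuous.intervalIntegrable (by fun_prop) _ _), intervalIntegral.integral_const_mul,
      intervalIntegral.integral_const, smul_eq_mul] at hint
    simp only [hD]
    linarith
  have hD0 : ∀ t, 0 ≤ D t := fun t => intervalIntegral.integral_nonneg hle fun _ _ => sq_nonneg _
  -- The difference of the memory terms is not controlled by `D` at the same time, so its square
  -- joins the energy; its derivative is `2 (E₁ - E₂) c`, and `c` is bounded by `M N`.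
  have hQ : D τ + (E₁ τ - E₂ τ) ^ 2 ≤ 0 := by
    set K : ℝ := a + 2 * π * (b * (2 * π)) + 2 * π * M + M ^ 2 * (2 * π) + 1
    have hdE : ∀ t, HasDerivAt (fun t => (E₁ t - E₂ t) ^ 2) (2 * (E₁ t - E₂ t) * c t) t := by
      intro t
      refine (((dE u₁ c1 t).sub (dE u₂ c2 t)).pow 2).congr_deriv ?_
      rw [← hsub t]
      simp [hE1, hE2]
    have hE : Continuous fun t => (E₁ t - E₂ t) ^ 2 :=
      continuous_iff_continuousAt.2 fun t => (hdE t).continuousAt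
    refine nonpos_of_deriv_le_mul (Q := fun t => D t + (E₁ t - E₂ t) ^ 2) (K := K) (T := T)
      ((csq d cd).add hE).continuousOn ?_ (fun t ht => (dD t ht).add (hdE t)) ?_ hτ
    · have : D 0 = 0 := by
        simp only [hD]
        rw [intervalIntegral.integral_congr (g := fun _ => (0 : ℝ)) fun y hy => ?_]
        · simp
        · rw [uIcc_of_le hle] at hy
          simp [hd, h0 y hy]
      simp [this, hE1, hE2]
    · intro t ht
      have ht' := Ioo_subset_Icc_self ht
      have hcb := hcN t ht'
      have s1 : c t ^ 2 ≤ (M * N t) ^ 2 := sq_le_sq' (neg_le_of_abs_le hcb) (le_of_abs_le hcb)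
      have s2 : 2 * (E₁ t - E₂ t) * c t ≤ (E₁ t - E₂ t) ^ 2 + M ^ 2 * N t ^ 2 := by
        nlinarith [sq_nonneg (E₁ t - E₂ t - c t)]
      have s3 := hND t
      have hb0 : 0 ≤ b := add_nonneg hM0 (sq_nonneg M)
      have ha0 : 0 ≤ a := by positivity
      have s4 := mul_le_mul_of_nonneg_left s3 (sq_nonneg M)
      have s5 := mul_le_mul_of_nonneg_left s3 (mul_nonneg (mul_nonneg two_pos.le hπ.le) hb0)
      have s6 := hJ t ht
      have p1 : 0 ≤ 2 * π * M * D t := mul_nonneg (by positivity) (hD0 t)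
      have p2 : 0 ≤ (a + 2 * π * (b * (2 * π)) + M ^ 2 * (2 * π)) * (E₁ t - E₂ t) ^ 2 := by
        positivity
      have p3 := hD0 t
      have p4 : K * (D t + (E₁ t - E₂ t) ^ 2) = a * D t + 2 * π * b * (2 * π * D t)
          + M ^ 2 * (2 * π * D t) + 2 * π * M * D t + D t
          + (a + 2 * π * (b * (2 * π)) + M ^ 2 * (2 * π)) * (E₁ t - E₂ t) ^ 2
          + 2 * π * M * (E₁ t - E₂ t) ^ 2 + (E₁ t - E₂ t) ^ 2 := by
        simp only [K]; ring
      rw [p4]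
      linarith
  have hDτ : D τ = 0 := le_antisymm (by linarith [sq_nonneg (E₁ τ - E₂ τ)]) (hD0 τ)
  have i := cont_at d cd τ
  by_contra hne
  have hpos : 0 < D τ := intervalIntegral.integral_pos (by linarith) (by fun_prop)
    (fun _ _ => sq_nonneg _) ⟨x, hx, by
      have : d τ x ≠ 0 := sub_ne_zero.2 hne
      positivity⟩
  linarith

/-- Freezing time and position outside the compact rectangle gives globally continuous functions and
leaves every integral in the equation unchanged. -/
theorem IsC3Solution.isEvolution {b₀ : ℝ → ℝ} {T T' : ℝ} {b : ℝ → ℝ → ℝ}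
    (h : IsC3Solution b₀ T b) (hT' : 0 ≤ T') (hT : T' < T) :
    IsEvolution T' (fun τ x => b (clamp 0 T' τ) (clamp (-π) π x))
      (fun τ x => iteratedDerivWithin 1 (b (clamp 0 T' τ)) Om (clamp (-π) π x)) := by
  have hsub : Icc 0 T' ⊆ Ico 0 T := fun s hs => ⟨hs.1, hs.2.trans_lt hT⟩
  have hcl : Continuous fun p : ℝ × ℝ => ((clamp 0 T' p.1, clamp (-π) π p.2) : ℝ × ℝ) :=
    ((continuous_clamp 0 T').comp continuous_fst).prodMk
      ((continuous_clamp (-π) π).comp continuous_snd)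
  have hcont : ∀ j ≤ 3, Continuous fun p : ℝ × ℝ =>
      iteratedDerivWithin j (b (clamp 0 T' p.1)) Om (clamp (-π) π p.2) := fun j hj =>
    (h.continuousOn j hj).comp_continuous hcl fun p => ⟨hsub (clamp_mem hT' _), clamp_mem_Om _⟩
  have hspace : ∀ τ ∈ Icc 0 T', ∀ x ∈ Om, HasDerivWithinAt (b τ)
      (iteratedDerivWithin 1 (b τ) Om x) Om x := fun τ hτ x hx => by
    have := hasDerivWithinAt_iteratedDerivWithin (h.contDiffOn τ (hsub hτ)) (j := 0)
      (by norm_num) hx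
    rwa [iteratedDerivWithin_zero] at this
  refine ⟨by simpa using hcont 0 (by norm_num), hcont 1 (by norm_num), ?_, ?_⟩
  · intro τ hτ x hx
    rw [clamp_of_mem hτ, clamp_of_mem hx]
    exact (hspace τ hτ x hx).congr (fun y hy => by rw [clamp_of_mem hy]) (by rw [clamp_of_mem hx])
  · intro τ hτ x hx
    have hτ' := Ioo_subset_Icc_self hτ
    have hd := (h.equation τ (hsub hτ') x hx).hasDerivAt (Ici_mem_nhds hτ.1)
    have hrate : rate (fun τ x => b (clamp 0 T' τ) (clamp (-π) π x))
        (fun τ x => iteratedDerivWithin 1 (b (clamp 0 T' τ)) Om (clamp (-π) π x)) τ x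
        = rhs b τ x := by
      have hint : ∀ (g : ℝ → ℝ) {z : ℝ}, z ∈ Om →
          ∫ y in (-π)..z, g (clamp (-π) π y) = ∫ y in (-π)..z, g y := fun g z hz =>
        intervalIntegral.integral_congr fun y hy => by
          rw [uIcc_of_le hz.1] at hy
          simp only [clamp_of_mem (show y ∈ Icc (-π) π from ⟨hy.1, hy.2.trans hz.2⟩)]
      have hpi : π ∈ Om := ⟨by linarith [pi_pos], le_rfl⟩
      have htime : ∫ s in (0 : ℝ)..τ, ∫ y in (-π)..π, b (clamp 0 T' s) y ^ 2
          = ∫ s in (0 : ℝ)..τ, ∫ y in (-π)..π, b s y ^ 2 :=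
        intervalIntegral.integral_congr fun s hs => by
          rw [uIcc_of_le hτ'.1] at hs
          simp only [clamp_of_mem (show s ∈ Icc 0 T' from ⟨hs.1, hs.2.trans hτ'.2⟩)]
      have hsq : ∀ s, ∫ y in (-π)..π, b (clamp 0 T' s) (clamp (-π) π y) ^ 2
          = ∫ y in (-π)..π, b (clamp 0 T' s) y ^ 2 := fun s =>
        hint (fun y => b (clamp 0 T' s) y ^ 2) hpi
      have hsq' : ∫ y in (-π)..π, b τ (clamp (-π) π y) ^ 2 = ∫ y in (-π)..π, b τ y ^ 2 :=
        hint (fun y => b τ y ^ 2) hpi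
      simp only [rate, rhs, hsq, htime, hsq', clamp_of_mem hτ', clamp_of_mem hx, hint (b τ) hx,
        (hspace τ hτ' x hx).derivWithin (uniqueDiffOn_Om x hx)]
    rw [hrate]
    refine hd.congr_of_eventuallyEq ?_
    filter_upwards [Icc_mem_nhds hτ.1 hτ.2] with s hs
    rw [clamp_of_mem hs, clamp_of_mem hx]

theorem IsC3Solution.eqOn {b₀ : ℝ → ℝ} {T₁ T₂ : ℝ} {b₁ b₂ : ℝ → ℝ → ℝ}
    (h₁ : IsC3Solution b₀ T₁ b₁) (h₂ : IsC3Solution b₀ T₂ b₂)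
    (hmean : ∀ τ ∈ Ico 0 T₂, ∫ y in (-π)..π, b₂ τ y = 0) {τ x : ℝ} (hτ : τ ∈ Ico 0 T₁)
    (hτ' : τ ∈ Ico 0 T₂) (hx : x ∈ Om) : b₁ τ x = b₂ τ x := by
  have h0 : (0 : ℝ) ∈ Icc 0 τ := ⟨le_rfl, hτ.1⟩
  have key := (h₁.isEvolution hτ.1 hτ.2).eqOn (h₂.isEvolution hτ.1 hτ'.2)
    (fun y hy => by rw [clamp_of_mem h0, clamp_of_mem hy, h₁.initial y hy, h₂.initial y hy])
    (fun s hs => by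
      refine Eq.trans ?_ (hmean s ⟨hs.1, hs.2.trans_lt hτ'.2⟩)
      refine intervalIntegral.integral_congr fun y hy => ?_
      rw [uIcc_of_le (by linarith [pi_pos])] at hy
      simp only [clamp_of_mem hy, clamp_of_mem hs]) ⟨hτ.1, le_rfl⟩ hx
  simpa only [clamp_of_mem hx, clamp_of_mem (show τ ∈ Icc 0 τ from ⟨hτ.1, le_rfl⟩)] using key

/-! ### The quadratic model near the maximum -/

/-- `p` is a positive profile on `[-π, π]` with a single quadratic zero at `a`, and `p'` is
comparable with its derivative. -/
structure IsProfile (p p' : ℝ → ℝ) (a A : ℝ) : Prop where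
  cont : Continuous p
  abs_center_le : |a| ≤ 1
  lower : 1 / 4 ≤ A
  upper : A ≤ 1
  sq_le : ∀ α ∈ Om, (α - a) ^ 2 / 40 ≤ p α
  taylor : ∀ α ∈ Om, |p α - A * (α - a) ^ 2| ≤ 2 * |α - a| ^ 3
  taylor_deriv : ∀ α ∈ Om, |p' α - 2 * A * (α - a)| ≤ 2 * (α - a) ^ 2

/-- The denominator of the Jacobian in terms of the profile and of `r = √(1 - η m)`. -/
def den (p : ℝ → ℝ) (r α : ℝ) : ℝ := r ^ 2 + (1 - r ^ 2) * p α

/-- The quadratic model of `den`. -/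
def modelDen (a A r α : ℝ) : ℝ := r ^ 2 + A * (α - a) ^ 2

/-- The flow map of the quadratic model. -/
noncomputable def modelFlow (a A r α : ℝ) : ℝ := 2 * arctan (√A * (α - a) / r)

section

variable {p p' : ℝ → ℝ} {a A r : ℝ}

theorem IsProfile.abs_sub_le (h : IsProfile p p' a A) {α : ℝ} (hα : α ∈ Om) : |α - a| ≤ 5 := by
  have h1 := abs_le.1 h.abs_center_le
  have h2 := pi_lt_d2
  rw [abs_le]
  constructor <;> linarith [hα.1, hα.2, h1.1, h1.2]

theorem IsProfile.le_den (h : IsProfile p p' a A) (hr1 : r ≤ 1) (hr0 : 0 < r) {α : ℝ}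
    (hα : α ∈ Om) : (r ^ 2 + (α - a) ^ 2) / 40 ≤ den p r α := by
  have h1 : (α - a) ^ 2 ≤ 25 := by
    have := h.abs_sub_le hα
    rw [← sq_abs]
    nlinarith [abs_nonneg (α - a)]
  have h2 : r ^ 2 ≤ 1 := by nlinarith
  have h3 := mul_le_mul_of_nonneg_left (h.sq_le α hα) (sub_nonneg.2 h2)
  unfold den
  nlinarith [mul_nonneg (sq_nonneg r) (sub_nonneg.2 h1)]

theorem IsProfile.den_pos (h : IsProfile p p' a A) (hr1 : r ≤ 1) (hr0 : 0 < r) {α : ℝ}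
    (hα : α ∈ Om) : 0 < den p r α :=
  lt_of_lt_of_le (by positivity) (h.le_den hr1 hr0 hα)

theorem IsProfile.den_le (h : IsProfile p p' a A) {α : ℝ}
    (hα : α ∈ Om) : den p r α ≤ r ^ 2 + 11 * (α - a) ^ 2 := by
  have h1 := (abs_le.1 (h.taylor α hα)).2
  have h2 := h.abs_sub_le hα
  have h3 : |α - a| ^ 3 ≤ 5 * (α - a) ^ 2 := by
    rw [← sq_abs (α - a)]
    nlinarith [sq_nonneg |α - a|]
  have h4 : A * (α - a) ^ 2 ≤ 1 * (α - a) ^ 2 :=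
    mul_le_mul_of_nonneg_right h.upper (sq_nonneg _)
  have h5 : 0 ≤ p α := le_trans (by positivity) (h.sq_le α hα)
  unfold den
  nlinarith [mul_nonneg (sq_nonneg r) h5]

theorem IsProfile.le_modelDen (h : IsProfile p p' a A) (α : ℝ) :
    (r ^ 2 + (α - a) ^ 2) / 4 ≤ modelDen a A r α := by
  have := mul_le_mul_of_nonneg_right h.lower (sq_nonneg (α - a))
  unfold modelDen
  nlinarith [sq_nonneg r]

theorem IsProfile.modelDen_pos (h : IsProfile p p' a A) (hr0 : 0 < r) (α : ℝ) :
    0 < modelDen a A r α :=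
  lt_of_lt_of_le (by positivity) (h.le_modelDen α)

/-- With `S² = r² + (α - a)²` the denominators differ by at most `3 S³`, the cubic Taylor error, and
are at least `S²/40` and `S²/4`; this gives `3 · 160 = 480`. The bound is only logarithmically
non-integrable as `r → 0`, one order better than the main term. -/
theorem IsProfile.abs_inv_den_sub_le (h : IsProfile p p' a A) (hr1 : r ≤ 1) (hr0 : 0 < r) {α : ℝ}
    (hα : α ∈ Om) :
    |(den p r α)⁻¹ - (modelDen a A r α)⁻¹| ≤ 480 * (√(r ^ 2 + (α - a) ^ 2))⁻¹ := by
  have hW := h.le_den hr1 hr0 hα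
  have hV := h.le_modelDen (r := r) α
  have hW0 := h.den_pos hr1 hr0 hα
  have hV0 := h.modelDen_pos hr0 α
  set S := √(r ^ 2 + (α - a) ^ 2) with hS
  have hS0 : 0 < S := sqrt_pos.2 (by positivity)
  have hS2 : S ^ 2 = r ^ 2 + (α - a) ^ 2 := sq_sqrt (by positivity)
  have hxS : |α - a| ≤ S := abs_le_sqrt (by nlinarith)
  have hrS : r ≤ S := le_sqrt_of_sq_le (by nlinarith [sq_nonneg (α - a)])
  have hdiff : |modelDen a A r α - den p r α| ≤ 3 * S ^ 3 := by
    have h1 : modelDen a A r α - den p r α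
        = -((1 - r ^ 2) * (p α - A * (α - a) ^ 2)) + r ^ 2 * (A * (α - a) ^ 2) := by
      unfold modelDen den; ring
    have hr2 : r ^ 2 ≤ 1 := by nlinarith
    have h2 : |(1 - r ^ 2) * (p α - A * (α - a) ^ 2)| ≤ 1 * (2 * S ^ 3) := by
      rw [abs_mul, abs_of_nonneg (sub_nonneg.2 hr2)]
      refine mul_le_mul (by nlinarith [sq_nonneg r]) ((h.taylor α hα).trans ?_) (abs_nonneg _)
        zero_le_one
      gcongr
    have h3 : |r ^ 2 * (A * (α - a) ^ 2)| ≤ S ^ 3 := by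
      have hA := h.lower
      rw [abs_of_nonneg (by positivity)]
      calc r ^ 2 * (A * (α - a) ^ 2) = r * r * (A * |α - a| ^ 2) := by rw [sq_abs]; ring
        _ ≤ 1 * S * (1 * S ^ 2) := by
          gcongr
          exact h.upper
        _ = S ^ 3 := by ring
    rw [h1]
    refine (abs_add_le _ _).trans ?_
    rw [abs_neg]
    linarith
  rw [inv_sub_inv hW0.ne' hV0.ne', abs_div, abs_of_pos (mul_pos hW0 hV0),
    div_le_iff₀ (mul_pos hW0 hV0)]
  rw [← hS2] at hW hV
  refine hdiff.trans ?_
  have h4 : S ^ 2 / 40 * (S ^ 2 / 4) ≤ den p r α * modelDen a A r α :=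
    mul_le_mul hW hV (by positivity) hW0.le
  calc 3 * S ^ 3 = 480 * S⁻¹ * (S ^ 2 / 40 * (S ^ 2 / 4)) := by field_simp; norm_num
    _ ≤ _ := by gcongr

/-- Gives away the logarithm for a square root: `log z = 2 log √z ≤ 2 √z`. This is the origin of the
powers `√r` in the errors below. -/
theorem arsinh_le {y : ℝ} (hy : 0 ≤ y) : arsinh y ≤ 2 * √(1 + 2 * y) := by
  have h1 : √(1 + y ^ 2) ≤ 1 + y := by
    rw [sqrt_le_left (by linarith)]
    nlinarith
  have h2 : 0 < y + √(1 + y ^ 2) := by positivity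
  have h3 : 0 < √(y + √(1 + y ^ 2)) := sqrt_pos.2 h2
  have h4 := log_le_sub_one_of_pos h3
  rw [log_sqrt h2.le] at h4
  have h5 : √(y + √(1 + y ^ 2)) ≤ √(1 + 2 * y) := sqrt_le_sqrt (by linarith)
  rw [arsinh]
  linarith

theorem integral_inv_sqrt (hr0 : 0 < r) (a c d : ℝ) :
    ∫ α in c..d, (√(r ^ 2 + (α - a) ^ 2))⁻¹ = arsinh ((d - a) / r) - arsinh ((c - a) / r) := by
  have hc : Continuous fun α : ℝ => (√(r ^ 2 + (α - a) ^ 2))⁻¹ :=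
    Continuous.inv₀ (by fun_prop) fun α => (sqrt_pos.2 (by positivity)).ne'
  refine intervalIntegral.integral_eq_sub_of_hasDerivAt (f := fun α => arsinh ((α - a) / r))
    (fun α _ => ?_) (hc.intervalIntegrable _ _)
  refine ((((hasDerivAt_id α).sub_const a).div_const r).arsinh).congr_deriv ?_
  have h1 : √(r ^ 2 + (α - a) ^ 2) = r * √(1 + ((α - a) / r) ^ 2) := by
    rw [← sqrt_sq hr0.le, ← sqrt_mul (sq_nonneg r), sqrt_sq hr0.le]
    congr 1
    field_simp
  have h2 : 0 < √(1 + ((α - a) / r) ^ 2) := sqrt_pos.2 (by positivity)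
  rw [h1]
  simp only [id, smul_eq_mul]
  field_simp

theorem IsProfile.hasDerivAt_modelFlow (h : IsProfile p p' a A) (hr0 : 0 < r) (α : ℝ) :
    HasDerivAt (fun α => modelFlow a A r α / (2 * √A * r)) (modelDen a A r α)⁻¹ α := by
  have hA : 0 < A := lt_of_lt_of_le (by norm_num) h.lower
  have hsA : 0 < √A := sqrt_pos.2 hA
  have h1 : √A ^ 2 = A := sq_sqrt hA.le
  refine (((((((hasDerivAt_id α).sub_const a).const_mul √A).div_const r).arctan).const_mul
    2).div_const (2 * √A * r)).congr_deriv ?_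
  have h2 := (h.modelDen_pos hr0 α).ne'
  unfold modelDen at *
  have h3 : 1 + (√A * (id α - a) / r) ^ 2 = (r ^ 2 + A * (α - a) ^ 2) / r ^ 2 := by
    rw [div_pow, mul_pow, h1]
    field_simp
    simp
  rw [h3]
  field_simp

theorem IsProfile.half_le_sqrt (h : IsProfile p p' a A) : 1 / 2 ≤ √A :=
  le_sqrt_of_sq_le (by linarith [h.lower])

theorem IsProfile.sqrt_curvature_le_one (h : IsProfile p p' a A) : √A ≤ 1 :=
  sqrt_le_one.2 h.upper

theorem abs_half_pi_sub_arctan_le {y : ℝ} (hy : 0 < y) : |π / 2 - arctan y| ≤ y⁻¹ := by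
  have h1 := arctan_inv_of_pos hy
  have h2 : arctan y⁻¹ ≤ y⁻¹ := by
    have h0 := le_tan (arctan_nonneg.2 (inv_pos.2 hy).le) (arctan_lt_pi_div_two y⁻¹)
    rwa [tan_arctan] at h0
  have h3 := arctan_lt_pi_div_two y
  rw [abs_of_pos (by linarith)]
  linarith

theorem IsProfile.abs_modelFlow_neg_pi (h : IsProfile p p' a A) (hr0 : 0 < r) :
    |modelFlow a A r (-π) + π| ≤ 2 * r := by
  have h1 := abs_le.1 h.abs_center_le
  have h2 := pi_gt_three
  have h3 := h.half_le_sqrt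
  have hy : 0 < √A * (π + a) / r := by
    have : 0 < π + a := by linarith
    positivity
  have hya : 1 ≤ √A * (π + a) := by nlinarith
  have h4 := abs_half_pi_sub_arctan_le hy
  have h5 : √A * (-π - a) / r = -(√A * (π + a) / r) := by ring
  have h6 : (√A * (π + a) / r)⁻¹ ≤ r := by
    rw [inv_div, div_le_iff₀ (by linarith)]
    nlinarith
  rw [modelFlow, h5, arctan_neg]
  rw [show 2 * -arctan (√A * (π + a) / r) + π = 2 * (π / 2 - arctan (√A * (π + a) / r)) by ring,
    abs_mul, abs_two]
  linarith

theorem IsProfile.abs_modelFlow_pi (h : IsProfile p p' a A) (hr0 : 0 < r) :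
    |modelFlow a A r π - π| ≤ 2 * r := by
  have h1 := abs_le.1 h.abs_center_le
  have h2 := pi_gt_three
  have h3 := h.half_le_sqrt
  have hy : 0 < √A * (π - a) / r := by
    have : 0 < π - a := by linarith
    positivity
  have hya : 1 ≤ √A * (π - a) := by nlinarith
  have h4 := abs_half_pi_sub_arctan_le hy
  have h6 : (√A * (π - a) / r)⁻¹ ≤ r := by
    rw [inv_div, div_le_iff₀ (by linarith)]
    nlinarith
  rw [modelFlow]
  rw [show 2 * arctan (√A * (π - a) / r) - π = -(2 * (π / 2 - arctan (√A * (π - a) / r))) by ring,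
    abs_neg, abs_mul, abs_two]
  linarith

theorem IsProfile.continuousOn_inv_den (h : IsProfile p p' a A) (hr1 : r ≤ 1) (hr0 : 0 < r) :
    ContinuousOn (fun α => (den p r α)⁻¹) Om := by
  have hc : ContinuousOn (den p r) Om := by
    have := h.cont
    unfold den
    fun_prop
  exact hc.inv₀ fun α hα => (h.den_pos hr1 hr0 hα).ne'

theorem IsProfile.intervalIntegrable_inv_den (h : IsProfile p p' a A) (hr1 : r ≤ 1) (hr0 : 0 < r)
    {c d : ℝ} (hc : c ∈ Om) (hd : d ∈ Om) :
    IntervalIntegrable (fun α => (den p r α)⁻¹) volume c d :=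
  ((h.continuousOn_inv_den hr1 hr0).mono
    (OrdConnected.uIcc_subset ordConnected_Icc hc hd)).intervalIntegrable

theorem neg_pi_mem_Om : -π ∈ Om := ⟨le_rfl, by linarith [pi_pos]⟩

theorem pi_mem_Om : π ∈ Om := ⟨by linarith [pi_pos], le_rfl⟩

theorem one_le_inv_sqrt (hr1 : r ≤ 1) (hr0 : 0 < r) : 1 ≤ (√r)⁻¹ :=
  (one_le_inv₀ (sqrt_pos.2 hr0)).2 (sqrt_le_one.2 hr1)

/-- The model integral is an arctangent, and the integrated error is `480` times two `arsinh` terms,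
each at most `8/√r`. The last `2` replaces the model flow at `-π` by `-π` itself. -/
theorem IsProfile.abs_integral_inv_den_sub_le (h : IsProfile p p' a A) (hr1 : r ≤ 1) (hr0 : 0 < r)
    {α : ℝ} (hα : α ∈ Om) :
    |(∫ y in (-π)..α, (den p r y)⁻¹) - (modelFlow a A r α + π) / (2 * √A * r)|
      ≤ 7682 * (√r)⁻¹ := by
  have hπ := pi_gt_three
  have hπ' := pi_lt_d2
  have ha := abs_le.1 h.abs_center_le
  have hsr : 0 < √r := sqrt_pos.2 hr0
  have hmc : Continuous fun y => (modelDen a A r y)⁻¹ := by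
    refine Continuous.inv₀ ?_ fun y => (h.modelDen_pos hr0 y).ne'
    unfold modelDen
    fun_prop
  have hmodel : ∫ y in (-π)..α, (modelDen a A r y)⁻¹
      = modelFlow a A r α / (2 * √A * r) - modelFlow a A r (-π) / (2 * √A * r) :=
    intervalIntegral.integral_eq_sub_of_hasDerivAt (fun y _ => h.hasDerivAt_modelFlow hr0 y)
      (hmc.intervalIntegrable _ _)
  have hsc : Continuous fun y : ℝ => 480 * (√(r ^ 2 + (y - a) ^ 2))⁻¹ :=
    continuous_const.mul (Continuous.inv₀ (by fun_prop) fun y => (sqrt_pos.2 (by positivity)).ne')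
  have hi := h.intervalIntegrable_inv_den hr1 hr0 neg_pi_mem_Om hα
  have h1 : |∫ y in (-π)..α, ((den p r y)⁻¹ - (modelDen a A r y)⁻¹)| ≤ 7680 * (√r)⁻¹ := by
    have e1 : |∫ y in (-π)..α, ((den p r y)⁻¹ - (modelDen a A r y)⁻¹)|
        ≤ ∫ y in (-π)..α, 480 * (√(r ^ 2 + (y - a) ^ 2))⁻¹ := by
      refine (intervalIntegral.abs_integral_le_integral_abs hα.1).trans ?_
      exact intervalIntegral.integral_mono_on hα.1 (hi.sub (hmc.intervalIntegrable _ _)).abs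
        (hsc.intervalIntegrable _ _) fun y hy =>
          h.abs_inv_den_sub_le hr1 hr0 ⟨hy.1, hy.2.trans hα.2⟩
    have hmono : ∀ y : ℝ, y ≤ 5 → arsinh (y / r) ≤ 8 * (√r)⁻¹ := by
      intro y hy
      have e2 : arsinh (y / r) ≤ arsinh (5 / r) := arsinh_le_arsinh.2 (by gcongr)
      refine e2.trans ((arsinh_le (by positivity)).trans ?_)
      have e3 : √(1 + 2 * (5 / r)) ≤ √(4 ^ 2 / r) := by
        refine sqrt_le_sqrt ?_
        rw [show 1 + 2 * (5 / r) = (r + 10) / r by field_simp; ring]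
        gcongr
        linarith
      rw [sqrt_div (by norm_num), sqrt_sq (by norm_num)] at e3
      rw [div_eq_mul_inv 4 √r] at e3
      linarith
    rw [intervalIntegral.integral_const_mul, integral_inv_sqrt hr0] at e1
    have e4 := hmono (α - a) (by linarith [hα.2, ha.1])
    have e5 := hmono (π + a) (by linarith [ha.2])
    have e6 : arsinh ((-π - a) / r) = -arsinh ((π + a) / r) := by
      rw [← arsinh_neg]; congr 1; ring
    rw [e6] at e1
    linarith
  rw [intervalIntegral.integral_sub hi (hmc.intervalIntegrable _ _), hmodel] at h1
  have hsA := h.half_le_sqrt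
  have hden : 0 < 2 * √A * r := by positivity
  have h2 : |(modelFlow a A r (-π) + π) / (2 * √A * r)| ≤ 2 * (√r)⁻¹ := by
    rw [abs_div, abs_of_pos hden, div_le_iff₀ hden]
    refine (h.abs_modelFlow_neg_pi hr0).trans ?_
    have := one_le_inv_sqrt hr1 hr0
    nlinarith [mul_le_mul_of_nonneg_right this hr0.le,
      mul_nonneg (sub_nonneg.2 hsA) (mul_nonneg (inv_pos.2 hsr).le hr0.le)]
  have h3 : (∫ y in (-π)..α, (den p r y)⁻¹) - (modelFlow a A r α + π) / (2 * √A * r)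
      = ((∫ y in (-π)..α, (den p r y)⁻¹) - (modelFlow a A r α / (2 * √A * r)
        - modelFlow a A r (-π) / (2 * √A * r))) - (modelFlow a A r (-π) + π) / (2 * √A * r) := by
    ring
  rw [h3]
  refine (abs_sub _ _).trans ?_
  linarith

theorem IsProfile.abs_mean_sub_le (h : IsProfile p p' a A) (hr1 : r ≤ 1) (hr0 : 0 < r) :
    |(2 * π)⁻¹ * (∫ y in (-π)..π, (den p r y)⁻¹) - 1 / (2 * √A * r)| ≤ 7684 * (√r)⁻¹ := by
  have hπ := pi_gt_three
  have hsr : 0 < √r := sqrt_pos.2 hr0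
  have hsA := h.half_le_sqrt
  have hden : 0 < 2 * √A * r := by positivity
  have h1 := h.abs_integral_inv_den_sub_le hr1 hr0 pi_mem_Om
  have h2 : |(modelFlow a A r π - π) / (2 * √A * r)| ≤ 2 * (√r)⁻¹ := by
    rw [abs_div, abs_of_pos hden, div_le_iff₀ hden]
    refine (h.abs_modelFlow_pi hr0).trans ?_
    have := one_le_inv_sqrt hr1 hr0
    nlinarith [mul_le_mul_of_nonneg_right this hr0.le,
      mul_nonneg (sub_nonneg.2 hsA) (mul_nonneg (inv_pos.2 hsr).le hr0.le)]
  have h3 : (2 * π)⁻¹ * (∫ y in (-π)..π, (den p r y)⁻¹) - 1 / (2 * √A * r)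
      = (2 * π)⁻¹ * (((∫ y in (-π)..π, (den p r y)⁻¹) - (modelFlow a A r π + π) / (2 * √A * r))
        + (modelFlow a A r π - π) / (2 * √A * r)) := by
    field_simp
    ring
  rw [h3, abs_mul, abs_of_pos (by positivity)]
  have h4 := (abs_add_le _ _).trans (add_le_add h1 h2)
  have h5 : (2 * π)⁻¹ ≤ 1 := inv_le_one_of_one_le₀ (by linarith)
  refine (mul_le_mul h5 h4 (abs_nonneg _) zero_le_one).trans ?_
  linarith

/-- A non-asymptotic lower bound, valid also when `r` is not small: on `[a, a + r]` the denominator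
is at most `12 r²`, and `2π < 8`. -/
theorem IsProfile.le_mean (h : IsProfile p p' a A) (hr1 : r ≤ 1) (hr0 : 0 < r) :
    1 / (96 * r) ≤ (2 * π)⁻¹ * ∫ y in (-π)..π, (den p r y)⁻¹ := by
  have hπ := pi_gt_three
  have hπ' := pi_lt_d2
  have ha := abs_le.1 h.abs_center_le
  have hsub : ∀ y ∈ Icc a (a + r), y ∈ Om := fun y hy =>
    ⟨by linarith [hy.1, ha.1], by linarith [hy.2, ha.2]⟩
  have h1 : ∫ _ in a..(a + r), 1 / (12 * r ^ 2) ≤ ∫ y in a..(a + r), (den p r y)⁻¹ := by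
    refine intervalIntegral.integral_mono_on (by linarith) (by simp)
      (h.intervalIntegrable_inv_den hr1 hr0 (hsub a ⟨le_rfl, by linarith⟩)
        (hsub _ ⟨by linarith, le_rfl⟩)) fun y hy => ?_
    rw [one_div]
    refine inv_anti₀ (h.den_pos hr1 hr0 (hsub y hy)) ((h.den_le (hsub y hy)).trans ?_)
    nlinarith [hy.1, hy.2]
  have h2 : ∫ y in a..(a + r), (den p r y)⁻¹ ≤ ∫ y in (-π)..π, (den p r y)⁻¹ := by
    refine intervalIntegral.integral_mono_interval (by linarith [ha.1]) (by linarith)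
      (by linarith [ha.2]) ?_ (h.intervalIntegrable_inv_den hr1 hr0 neg_pi_mem_Om pi_mem_Om)
    refine (ae_restrict_iff' measurableSet_Ioc).2 (Eventually.of_forall fun y hy => ?_)
    exact (inv_pos.2 (h.den_pos hr1 hr0 ⟨hy.1.le, hy.2⟩)).le
  rw [intervalIntegral.integral_const, smul_eq_mul, add_sub_cancel_left] at h1
  have h3 := h1.trans h2
  have h4 : r * (1 / (12 * r ^ 2)) = 1 / (12 * r) := by field_simp
  rw [h4] at h3
  rw [inv_mul_eq_div, le_div_iff₀ (by positivity)]
  refine le_trans ?_ h3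
  rw [div_mul_eq_mul_div, one_mul, div_le_div_iff₀ (by positivity) (by positivity)]
  nlinarith

theorem IsProfile.abs_flow_sub_le (h : IsProfile p p' a A) (hr1 : r ≤ 1) (hr0 : 0 < r)
    {α : ℝ} (hα : α ∈ Om) :
    |-π + (∫ y in (-π)..α, (den p r y)⁻¹) / ((2 * π)⁻¹ * ∫ y in (-π)..π, (den p r y)⁻¹)
      - modelFlow a A r α| ≤ 6000000 * √r := by
  have h1 := h.abs_integral_inv_den_sub_le hr1 hr0 hα
  have h2 := h.abs_mean_sub_le hr1 hr0
  have h3 := h.le_mean hr1 hr0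
  set H := ∫ y in (-π)..α, (den p r y)⁻¹
  set G := (2 * π)⁻¹ * ∫ y in (-π)..π, (den p r y)⁻¹
  have hπ := pi_gt_three
  have hπ' := pi_lt_d2
  have hG : 0 < G := lt_of_lt_of_le (by positivity) h3
  set Y := modelFlow a A r α with hY
  have hYb : |Y + π| ≤ 7 := by
    have e1 := neg_pi_div_two_lt_arctan (√A * (α - a) / r)
    have e2 := arctan_lt_pi_div_two (√A * (α - a) / r)
    rw [hY, modelFlow, abs_le]
    constructor <;> linarith
  -- Both numerator and mean are compared with the model, so the factor `1/(2 √A r)` cancels. The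
  -- numerator is at most `7682 + 7 · 7684 < 62000` times `1/√r`, and `1/G ≤ 96 r`.
  have e : -π + H / G - Y
      = ((H - (Y + π) / (2 * √A * r)) - (Y + π) * (G - 1 / (2 * √A * r))) / G := by
    field_simp
    ring
  have hsr : 0 < √r := sqrt_pos.2 hr0
  have h4 : |(H - (Y + π) / (2 * √A * r)) - (Y + π) * (G - 1 / (2 * √A * r))|
      ≤ 62000 * (√r)⁻¹ := by
    refine (abs_sub _ _).trans ?_
    rw [abs_mul]
    have := mul_le_mul hYb h2 (abs_nonneg _) (by norm_num)
    have := inv_pos.2 hsr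
    linarith
  rw [e, abs_div, abs_of_pos hG, div_le_iff₀ hG]
  refine h4.trans ?_
  have h5 : 6000000 * √r * (1 / (96 * r)) ≤ 6000000 * √r * G := by gcongr
  refine le_trans ?_ h5
  have h6 : √r * √r = r := mul_self_sqrt hr0.le
  have h7 : 6000000 * √r * (1 / (96 * r)) = 62500 * (√r)⁻¹ := by
    field_simp
    nlinarith
  rw [h7]
  have := inv_pos.2 hsr
  linarith

/-- The key asymptotic identity: the derivative of the profile along the flow is a sine. -/
theorem IsProfile.abs_deriv_sub_sin_le (h : IsProfile p p' a A) (hr1 : r ≤ 1) (hr0 : 0 < r)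
    {α X s K : ℝ} (hα : α ∈ Om) (hX : |X - modelFlow a A r α| ≤ 6000000 * √r)
    (hs : r / 48 ≤ s) (hs' : |s - r / √A| ≤ K * (r * √r)) (hK : 0 ≤ K) :
    |p' α * (den p r α)⁻¹ - sin X / s| ≤ (1040 + 48 * K + 288000000) * (√r)⁻¹ := by
  have hsr : 0 < √r := sqrt_pos.2 hr0
  have hs0 : 0 < s := lt_of_lt_of_le (by positivity) hs
  have hsA := h.half_le_sqrt
  have hsA0 : 0 < √A := by linarith
  have hA2 : √A ^ 2 = A := sq_sqrt (by linarith [h.lower])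
  have hW := h.le_den hr1 hr0 hα
  have hW0 := h.den_pos hr1 hr0 hα
  have hV0 := h.modelDen_pos hr0 α
  set x := α - a with hx
  set Y := modelFlow a A r α with hY
  set S := √(r ^ 2 + x ^ 2) with hS
  have hS0 : 0 < S := sqrt_pos.2 (by positivity)
  have hxS : |x| ≤ S := abs_le_sqrt (by nlinarith)
  have h1 : |(p' α - 2 * A * x) * (den p r α)⁻¹| ≤ 80 := by
    rw [abs_mul, abs_of_pos (inv_pos.2 hW0), ← div_eq_mul_inv, div_le_iff₀ hW0]
    refine (h.taylor_deriv α hα).trans ?_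
    nlinarith [sq_nonneg r]
  have h2 : |2 * A * x * ((den p r α)⁻¹ - (modelDen a A r α)⁻¹)| ≤ 960 := by
    rw [abs_mul]
    have e1 : |2 * A * x| ≤ 2 * S := by
      rw [abs_mul, abs_of_nonneg (by linarith [h.lower])]
      have := mul_le_mul h.upper hxS (abs_nonneg x) zero_le_one
      linarith
    refine (mul_le_mul e1 (h.abs_inv_den_sub_le hr1 hr0 hα) (abs_nonneg _) (by positivity)).trans ?_
    rw [← hx, ← hS]
    field_simp
    norm_num
  -- With `t = √A x/r = tan(Y/2)` this is `sin Y = 2t/(1 + t²)`.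
  have hsin : 2 * A * x * (modelDen a A r α)⁻¹ = sin Y * (√A / r) := by
    have e1 : sin Y = 2 * (√A * x / r) / (1 + (√A * x / r) ^ 2) := by
      rw [hY, modelFlow, sin_two_mul, sin_arctan, cos_arctan, ← hx]
      have : 0 < 1 + (√A * x / r) ^ 2 := by positivity
      rw [mul_assoc, div_mul_div_comm, mul_one, mul_self_sqrt this.le]
      ring
    have e2 : 1 + (√A * x / r) ^ 2 = modelDen a A r α / r ^ 2 := by
      rw [modelDen, div_pow, mul_pow, hA2, ← hx]
      field_simp
    rw [e1, e2]
    field_simp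
    rw [hA2, mul_comm]
  have h3 : |sin Y * (√A / r) - sin Y / s| ≤ 48 * K * (√r)⁻¹ := by
    have e1 : sin Y * (√A / r) - sin Y / s = sin Y * (√A * (s - r / √A) / (r * s)) := by
      field_simp
    rw [e1, abs_mul, abs_div, abs_mul, abs_of_pos hsA0, abs_of_pos (mul_pos hr0 hs0)]
    have e2 : √A * |s - r / √A| / (r * s) ≤ 48 * K * (√r)⁻¹ := by
      rw [div_le_iff₀ (mul_pos hr0 hs0)]
      calc √A * |s - r / √A| ≤ 1 * (K * (r * √r)) :=
            mul_le_mul h.sqrt_curvature_le_one hs' (abs_nonneg _) zero_le_one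
        _ = 48 * K * (√r)⁻¹ * (r * (r / 48)) := by
            have h6 : √r * √r = r := mul_self_sqrt hr0.le
            field_simp
            rw [pow_two, h6]
        _ ≤ 48 * K * (√r)⁻¹ * (r * s) := by gcongr
    have e3 := abs_sin_le_one Y
    have e4 : 0 ≤ √A * |s - r / √A| / (r * s) := by positivity
    nlinarith
  have h4 : |(sin Y - sin X) / s| ≤ 288000000 * (√r)⁻¹ := by
    rw [abs_div, abs_of_pos hs0, div_le_iff₀ hs0]
    have e1 : |sin Y - sin X| ≤ |X - Y| := by
      rw [abs_sub_comm X Y]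
      have := LipschitzWith.dist_le_mul lipschitzWith_sin Y X
      simpa [Real.dist_eq] using this
    refine (e1.trans hX).trans ?_
    calc 6000000 * √r = 288000000 * (√r)⁻¹ * (r / 48) := by
          have h6 : √r * √r = r := mul_self_sqrt hr0.le
          field_simp
          nlinarith
      _ ≤ _ := by gcongr
  -- Four errors: Taylor remainder of `p'`, quadratic model of the denominator, replacement of
  -- `r/√A` by `s`, and of the model flow by the true position `X`.
  have h5 : p' α * (den p r α)⁻¹ - sin X / s = (p' α - 2 * A * x) * (den p r α)⁻¹
      + 2 * A * x * ((den p r α)⁻¹ - (modelDen a A r α)⁻¹)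
      + (sin Y * (√A / r) - sin Y / s) + (sin Y - sin X) / s := by
    rw [mul_sub (2 * A * x), hsin]
    ring
  rw [h5]
  have h6 := one_le_inv_sqrt hr1 hr0
  refine (abs_add_le _ _).trans ((add_le_add ((abs_add_le _ _).trans
    (add_le_add (abs_add_le _ _) le_rfl)) le_rfl).trans ?_)
  linarith

end

/-! ### The blow-up time and the asymptotics in physical time -/

section

variable {β p' : ℝ → ℝ} {m a A η : ℝ}

/-- The small parameter that measures the distance of `η` to the blow-up. -/
noncomputable def gap (m η : ℝ) : ℝ := √(1 - η * m)

theorem IsAmplitude.Ico_subset (h : IsAmplitude β m) : Ico 0 (1 / m) ⊆ paramRange m :=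
  fun _ hη => ⟨h.zero_mem.1.trans_le hη.1, hη.2⟩

theorem IsAmplitude.mul_lt_one (h : IsAmplitude β m) (hη : η ∈ Ico 0 (1 / m)) : η * m < 1 :=
  (lt_div_iff₀ h.pos).1 hη.2

theorem IsAmplitude.gap_pos (h : IsAmplitude β m) (hη : η ∈ Ico 0 (1 / m)) : 0 < gap m η :=
  sqrt_pos.2 (by linarith [h.mul_lt_one hη])

theorem IsAmplitude.gap_le_one (h : IsAmplitude β m) (hη : η ∈ Ico 0 (1 / m)) : gap m η ≤ 1 :=
  sqrt_le_one.2 (by linarith [mul_nonneg hη.1 h.pos.le])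

theorem IsAmplitude.gap_sq (h : IsAmplitude β m) (hη : η ∈ Ico 0 (1 / m)) :
    gap m η ^ 2 = 1 - η * m := sq_sqrt (by linarith [h.mul_lt_one hη])

theorem IsAmplitude.jac_eq_inv_den (h : IsAmplitude β m) (hη : η ∈ Ico 0 (1 / m)) (α : ℝ) :
    jac β η α = (den (fun α => 1 - β α / m) (gap m η) α)⁻¹ := by
  have hm := h.pos.ne'
  rw [jac, den, h.gap_sq hη]
  congr 1
  field_simp
  ring

theorem IsAmplitude.moment_eq_integral_inv_den (h : IsAmplitude β m) (hη : η ∈ Ico 0 (1 / m))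
    (c d : ℝ) : moment β (fun _ => 1) 1 c d η
      = ∫ y in c..d, (den (fun α => 1 - β α / m) (gap m η) y)⁻¹ := by
  simp only [moment, one_mul, pow_one, h.jac_eq_inv_den hη]

theorem IsAmplitude.abs_meanJac_sub_le (h : IsAmplitude β m)
    (hp : IsProfile (fun α => 1 - β α / m) p' a A) (hη : η ∈ Ico 0 (1 / m)) :
    |meanJac β η - 1 / (2 * √A * gap m η)| ≤ 7684 * (√(gap m η))⁻¹ := by
  rw [meanJac, h.moment_eq_integral_inv_den hη]
  exact hp.abs_mean_sub_le (h.gap_le_one hη) (h.gap_pos hη)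

theorem IsAmplitude.le_meanJac (h : IsAmplitude β m)
    (hp : IsProfile (fun α => 1 - β α / m) p' a A) (hη : η ∈ Ico 0 (1 / m)) :
    1 / (96 * gap m η) ≤ meanJac β η := by
  rw [meanJac, h.moment_eq_integral_inv_den hη]
  exact hp.le_mean (h.gap_le_one hη) (h.gap_pos hη)

theorem IsAmplitude.abs_sub_modelFlow_le (h : IsAmplitude β m)
    (hp : IsProfile (fun α => 1 - β α / m) p' a A) (hη : η ∈ Ico 0 (1 / m)) {x : ℝ}
    (hx : x ∈ Om) :
    |x - modelFlow a A (gap m η) (label β η x)| ≤ 6000000 * √(gap m η) := by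
  have h1 := hp.abs_flow_sub_le (h.gap_le_one hη) (h.gap_pos hη) (h.label_mem (h.Ico_subset hη) hx)
  rw [← h.moment_eq_integral_inv_den hη, ← h.moment_eq_integral_inv_den hη] at h1
  have h2 := h.flow_label (h.Ico_subset hη) x
  rw [flow, meanJac] at h2
  rwa [h2] at h1

theorem IsAmplitude.hasDerivAt_gap (h : IsAmplitude β m) (hη : η ∈ Ico 0 (1 / m)) :
    HasDerivAt (gap m) (-m / (2 * gap m η)) η := by
  have h1 : HasDerivAt (fun s => 1 - s * m) (-(1 * m)) η :=
    ((hasDerivAt_id η).mul_const m).const_sub 1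
  refine (h1.sqrt (by linarith [h.mul_lt_one hη])).congr_deriv ?_
  rw [gap, one_mul]

theorem IsAmplitude.hasDerivAt_gap_mul_sqrt (h : IsAmplitude β m) (hη : η ∈ Ico 0 (1 / m)) :
    HasDerivAt (fun s => gap m s * √(gap m s)) (-(3 * m / 4) * (√(gap m η))⁻¹) η := by
  have h0 := h.gap_pos hη
  have hs : 0 < √(gap m η) := sqrt_pos.2 h0
  have h6 : √(gap m η) ^ 2 = gap m η := sq_sqrt h0.le
  refine ((h.hasDerivAt_gap hη).mul ((h.hasDerivAt_gap hη).sqrt h0.ne')).congr_deriv ?_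
  field_simp
  rw [h6]
  ring

theorem continuous_gap (m : ℝ) : Continuous (gap m) := by
  unfold gap; fun_prop

theorem IsAmplitude.gap_end (h : IsAmplitude β m) : gap m (1 / m) = 0 := by
  have := h.pos
  rw [gap, one_div, inv_mul_cancel₀ this.ne', sub_self, sqrt_zero]

/-- Comparison of the time with functions of the gap that have a larger, or smaller, slope. -/
theorem IsAmplitude.monotoneOn_physTime_add (h : IsAmplitude β m) {f f' : ℝ → ℝ}
    (hf : ∀ η ∈ Ico 0 (1 / m), HasDerivAt f (f' η) η)
    (hle : ∀ η ∈ Ico 0 (1 / m), 0 ≤ meanJac β η + f' η) :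
    MonotoneOn (fun η => physTime β η + f η) (Ico 0 (1 / m)) := by
  have hd : ∀ η ∈ Ico 0 (1 / m), HasDerivAt (fun η => physTime β η + f η) (meanJac β η + f' η) η :=
    fun η hη => (h.hasDerivAt_physTime (h.Ico_subset hη)).add (hf η hη)
  exact monotoneOn_of_hasDerivWithinAt_nonneg (convex_Ico _ _)
    (fun η hη => (hd η hη).continuousAt.continuousWithinAt)
    (fun η hη => (hd η (interior_subset hη)).hasDerivWithinAt)
    fun η hη => hle η (interior_subset hη)

theorem IsAmplitude.antitoneOn_physTime_add (h : IsAmplitude β m) {f f' : ℝ → ℝ}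
    (hf : ∀ η ∈ Ico 0 (1 / m), HasDerivAt f (f' η) η)
    (hle : ∀ η ∈ Ico 0 (1 / m), meanJac β η + f' η ≤ 0) :
    AntitoneOn (fun η => physTime β η + f η) (Ico 0 (1 / m)) := by
  have hd : ∀ η ∈ Ico 0 (1 / m), HasDerivAt (fun η => physTime β η + f η) (meanJac β η + f' η) η :=
    fun η hη => (h.hasDerivAt_physTime (h.Ico_subset hη)).add (hf η hη)
  exact antitoneOn_of_hasDerivWithinAt_nonpos (convex_Ico _ _)
    (fun η hη => (hd η hη).continuousAt.continuousWithinAt)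
    (fun η hη => (hd η (interior_subset hη)).hasDerivWithinAt)
    fun η hη => hle η (interior_subset hη)

/-- The blow-up time, and its asymptotic relation with the parameter `η`. -/
theorem IsAmplitude.exists_blowup_time (h : IsAmplitude β m)
    (hp : IsProfile (fun α => 1 - β α / m) p' a A) :
    ∃ τs : ℝ, 0 < τs ∧ physTime β '' Ico 0 (1 / m) = Ico 0 τs ∧ ∀ η ∈ Ico 0 (1 / m),
      |m * (τs - physTime β η) - gap m η / √A| ≤ 11000 * (gap m η * √(gap m η)) ∧
      gap m η / 48 ≤ m * (τs - physTime β η) := by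
  have hm := h.pos
  have hsA := hp.half_le_sqrt
  have hm1 : 0 < 1 / m := by positivity
  have h0mem : (0 : ℝ) ∈ Ico 0 (1 / m) := ⟨le_rfl, hm1⟩
  -- `-R` is an exact primitive of the leading part `1/(2 √A r)` of the mean Jacobian. The slope of
  -- `Q` is `-8250/√r`, since `11000 · 3/4 = 8250`, which beats the error `7684/√r`; hence `physTime
  -- + R ± Q` are monotone, in opposite directions.
  set R : ℝ → ℝ := fun η => gap m η / (m * √A) with hR
  set Q : ℝ → ℝ := fun η => 11000 / m * (gap m η * √(gap m η)) with hQ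
  have hRd : ∀ η ∈ Ico 0 (1 / m), HasDerivAt R (-(1 / (2 * √A * gap m η))) η := fun η hη => by
    refine ((h.hasDerivAt_gap hη).div_const _).congr_deriv ?_
    have := h.gap_pos hη
    field_simp
  have hQd : ∀ η ∈ Ico 0 (1 / m), HasDerivAt Q (-(8250 * (√(gap m η))⁻¹)) η := fun η hη => by
    refine ((h.hasDerivAt_gap_mul_sqrt hη).const_mul _).congr_deriv ?_
    field_simp
    norm_num
  have hinv : ∀ η ∈ Ico 0 (1 / m), 0 < (√(gap m η))⁻¹ := fun η hη =>
    inv_pos.2 (sqrt_pos.2 (h.gap_pos hη))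
  have hanti := h.antitoneOn_physTime_add (f := fun η => R η + Q η)
    (fun η hη => (hRd η hη).add (hQd η hη)) fun η hη => by
      have := (abs_le.1 (h.abs_meanJac_sub_le hp hη)).2
      linarith [hinv η hη]
  have hmono := h.monotoneOn_physTime_add (f := fun η => R η - Q η)
    (fun η hη => (hRd η hη).sub (hQd η hη)) fun η hη => by
      have := (abs_le.1 (h.abs_meanJac_sub_le hp hη)).1
      linarith [hinv η hη]
  have hlow := h.monotoneOn_physTime_add (f := fun η => gap m η / (48 * m))
    (fun η hη => (h.hasDerivAt_gap hη).div_const _) fun η hη => by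
      have := h.le_meanJac hp hη
      have h1 := h.gap_pos hη
      have h2 : -m / (2 * gap m η) / (48 * m) = -(1 / (96 * gap m η)) := by
        field_simp
        norm_num
      rw [h2]
      linarith
  have hTmono : StrictMonoOn (physTime β) (Ico 0 (1 / m)) :=
    h.strictMonoOn_physTime.mono h.Ico_subset
  have hRQ : ∀ η ∈ Ico 0 (1 / m), 0 ≤ R η + Q η := fun η hη => by
    have := h.gap_pos hη
    simp only [hR, hQ]
    positivity
  have hbdd : BddAbove (physTime β '' Ioo 0 (1 / m)) := by
    refine ⟨physTime β 0 + (R 0 + Q 0), ?_⟩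
    rintro _ ⟨η, hη, rfl⟩
    have hη' := Ioo_subset_Ico_self hη
    have h1 := hanti h0mem hη' hη'.1
    dsimp only at h1
    linarith [hRQ η hη']
  -- The time stays bounded as `η → 1/m`. As `R`, `Q` and the gap tend to zero there, passing to the
  -- limit in the three monotonicity statements compares `τs` with the time at any `η`.
  set τs := sSup (physTime β '' Ioo 0 (1 / m)) with hτs
  have hlim : Tendsto (physTime β) (𝓝[<] (1 / m)) (𝓝 τs) :=
    (hTmono.mono Ioo_subset_Ico_self).monotoneOn.tendsto_nhdsWithin_Ioo_left
      (nonempty_Ioo.2 hm1) hbdd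
  have hgap : Tendsto (gap m) (𝓝[<] (1 / m)) (𝓝 0) := by
    have := (continuous_gap m).tendsto (1 / m)
    rw [h.gap_end] at this
    exact this.mono_left nhdsWithin_le_nhds
  have hRlim : Tendsto R (𝓝[<] (1 / m)) (𝓝 0) := by
    simpa using hgap.div_const (m * √A)
  have hQlim : Tendsto Q (𝓝[<] (1 / m)) (𝓝 0) := by
    simpa using (hgap.mul hgap.sqrt).const_mul (11000 / m)
  have hclose : ∀ η ∈ Ico 0 (1 / m), ∀ᶠ s in 𝓝[<] (1 / m), s ∈ Ico 0 (1 / m) ∧ η ≤ s := by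
    intro η hη
    filter_upwards [Ioo_mem_nhdsLT hη.2] with s hs
    exact ⟨⟨hη.1.trans hs.1.le, hs.2⟩, hs.1.le⟩
  have hb1 : ∀ η ∈ Ico 0 (1 / m), τs ≤ physTime β η + (R η + Q η) := fun η hη => by
    have := le_of_tendsto (hlim.add (hRlim.add hQlim))
      ((hclose η hη).mono fun s hs => hanti hη hs.1 hs.2)
    simpa using this
  have hb2 : ∀ η ∈ Ico 0 (1 / m), physTime β η + (R η - Q η) ≤ τs := fun η hη => by
    have := ge_of_tendsto (hlim.add (hRlim.sub hQlim))
      ((hclose η hη).mono fun s hs => hmono hη hs.1 hs.2)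
    simpa using this
  have hb3 : ∀ η ∈ Ico 0 (1 / m), physTime β η + gap m η / (48 * m) ≤ τs := fun η hη => by
    have := ge_of_tendsto (hlim.add (hgap.div_const (48 * m)))
      ((hclose η hη).mono fun s hs => hlow hη hs.1 hs.2)
    simpa using this
  have hlt : ∀ η ∈ Ico 0 (1 / m), physTime β η < τs := fun η hη => by
    have := h.gap_pos hη
    have h1 : 0 < gap m η / (48 * m) := by positivity
    linarith [hb3 η hη]
  have hT0 : physTime β 0 = 0 := by simp [physTime]
  refine ⟨τs, by simpa [hT0] using hlt 0 h0mem, ?_, fun η hη => ⟨?_, ?_⟩⟩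
  · refine Subset.antisymm ?_ ?_
    · rintro _ ⟨η, hη, rfl⟩
      refine ⟨?_, hlt η hη⟩
      rw [← hT0]
      exact hTmono.monotoneOn h0mem hη hη.1
    · intro τ hτ
      obtain ⟨_, ⟨η, hη, rfl⟩, hη'⟩ := exists_lt_of_lt_csSup
        ((nonempty_Ioo.2 hm1).image _) hτ.2
      have hc : ContinuousOn (physTime β) (Icc 0 η) := fun s hs =>
        (h.hasDerivAt_physTime (h.Ico_subset
          ⟨hs.1, hs.2.trans_lt hη.2⟩)).continuousAt.continuousWithinAt
      obtain ⟨s, hs, rfl⟩ := intermediate_value_Icc hη.1.le hc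
        (show τ ∈ Icc (physTime β 0) (physTime β η) from ⟨by rw [hT0]; exact hτ.1, hη'.le⟩)
      exact ⟨s, ⟨hs.1, hs.2.trans_lt hη.2⟩, rfl⟩
  · have h1 := hb1 η hη
    have h2 := hb2 η hη
    have e1 : m * R η = gap m η / √A := by
      simp only [hR]; field_simp
    have e2 : m * Q η = 11000 * (gap m η * √(gap m η)) := by
      simp only [hQ]; field_simp
    rw [← e1, ← e2, abs_le]
    constructor <;> nlinarith
  · have h1 := mul_le_mul_of_nonneg_left (hb3 η hη) hm.le
    have e1 : m * (gap m η / (48 * m)) = gap m η / 48 := by field_simp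
    linarith

/-- Since `r ≤ 1`, the power `-1/2` may be weakened to `-3/4` before `r` is replaced by a multiple
of `s = m (τ* - τ)`. The constant is `11000 + 2`, the time error plus `1/√A ≤ 2`. -/
theorem inv_sqrt_le_rpow {r s : ℝ} (hr0 : 0 < r) (hr1 : r ≤ 1) (hs0 : 0 < s)
    (hs : s ≤ 11002 * r) : (√r)⁻¹ ≤ 11002 * s ^ (-(3 / 4) : ℝ) := by
  have h1 : (s / 11002) ≤ r := by
    rw [div_le_iff₀ (by norm_num)]; linarith
  have h2 : (√r)⁻¹ = r ^ (-(1 / 2) : ℝ) := by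
    rw [sqrt_eq_rpow, rpow_neg hr0.le]
  have h3 : r ^ (-(1 / 2) : ℝ) ≤ r ^ (-(3 / 4) : ℝ) :=
    rpow_le_rpow_of_exponent_ge hr0 hr1 (by norm_num)
  have h4 : r ^ (-(3 / 4) : ℝ) ≤ (s / 11002) ^ (-(3 / 4) : ℝ) :=
    rpow_le_rpow_of_nonpos (by positivity) h1 (by norm_num)
  have h5 : (s / 11002) ^ (-(3 / 4) : ℝ) ≤ 11002 * s ^ (-(3 / 4) : ℝ) := by
    rw [div_rpow hs0.le (by norm_num), div_eq_mul_inv, mul_comm]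
    refine mul_le_mul_of_nonneg_right ?_ (rpow_nonneg hs0.le _)
    rw [← rpow_neg (by norm_num), neg_neg]
    exact (rpow_le_rpow_of_exponent_le (by norm_num) (by norm_num : (3 / 4 : ℝ) ≤ 1)).trans
      (rpow_one _).le
  rw [h2]
  exact h3.trans (h4.trans h5)

theorem mul_rpow_neg_three_fourths {m σ : ℝ} (hm : 0 < m) (hσ : 0 < σ) :
    m * (m * σ) ^ (-(3 / 4) : ℝ) = m ^ (1 / 4 : ℝ) * σ ^ (-(3 / 4) : ℝ) := by
  rw [mul_rpow hm.le hσ.le, ← mul_assoc]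
  congr 1
  conv_lhs => rw [← rpow_one m, ← rpow_mul hm.le, one_mul, ← rpow_add hm]
  norm_num

/-- The sine asymptotics multiplied by `-m`, with `s = m σ`. The constant exceeds `11002 · (1040 +
48 · 11000 + 288000000)`. -/
theorem IsAmplitude.abs_velDeriv_add_le (h : IsAmplitude β m)
    (hp : IsProfile (fun α => 1 - β α / m) p' a A)
    (hp' : ∀ α ∈ Om, iteratedDerivWithin 1 β Om α = -m * p' α) {σ : ℝ} (hη : η ∈ Ico 0 (1 / m))
    (hσ : |m * σ - gap m η / √A| ≤ 11000 * (gap m η * √(gap m η)))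
    (hσ' : gap m η / 48 ≤ m * σ) {x : ℝ} (hx : x ∈ Om) :
    |velDeriv β η 1 x + sin x / σ|
      ≤ 3200000000000 * (m ^ (1 / 4 : ℝ) * σ ^ (-(3 / 4) : ℝ)) := by
  have hm := h.pos
  have hr0 := h.gap_pos hη
  have hr1 := h.gap_le_one hη
  have hz := h.label_mem (h.Ico_subset hη) hx
  have hs0 : 0 < m * σ := lt_of_lt_of_le (by positivity) hσ'
  have hσ0 : 0 < σ := (mul_pos_iff_of_pos_left hm).1 hs0
  have h1 := hp.abs_deriv_sub_sin_le hr1 hr0 hz (h.abs_sub_modelFlow_le hp hη hx) hσ' hσ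
    (by norm_num)
  have hsA := hp.half_le_sqrt
  have h2 : m * σ ≤ 11002 * gap m η := by
    have e1 := (abs_le.1 hσ).2
    have e2 : gap m η / √A ≤ 2 * gap m η := by
      rw [div_le_iff₀ (by linarith)]
      nlinarith
    have e3 : gap m η * √(gap m η) ≤ gap m η * 1 :=
      mul_le_mul_of_nonneg_left (sqrt_le_one.2 hr1) hr0.le
    linarith
  have h3 := inv_sqrt_le_rpow hr0 hr1 hs0 h2
  have h4 : velDeriv β η 1 x + sin x / σ = -m *
      (p' (label β η x) * (den (fun α => 1 - β α / m) (gap m η) (label β η x))⁻¹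
        - sin x / (m * σ)) := by
    simp only [velDeriv]
    rw [hp' _ hz, h.jac_eq_inv_den hη]
    field_simp
    ring
  rw [h4, abs_mul, abs_neg, abs_of_pos hm, ← mul_rpow_neg_three_fourths hm hσ0]
  refine (mul_le_mul_of_nonneg_left h1 hm.le).trans ?_
  have h5 := mul_le_mul_of_nonneg_left h3 hm.le
  have h6 : 0 ≤ m * (√(gap m η))⁻¹ := by positivity
  nlinarith

end

/-! ### Data close to the cosine -/

/-- One step of Taylor's formula by the mean value inequality. The factor `1/(n+1)` is lost, and
three steps still stay within the constants of `IsProfile`. -/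
theorem abs_sub_le_pow_succ {f f' : ℝ → ℝ} {a α C : ℝ} {n : ℕ} (hC : 0 ≤ C) (ha : a ∈ Om)
    (hα : α ∈ Om) (hf : ∀ t ∈ Om, HasDerivWithinAt f (f' t) Om t)
    (hb : ∀ t ∈ Om, |f' t| ≤ C * |t - a| ^ n) : |f α - f a| ≤ C * |α - a| ^ (n + 1) := by
  have hsub : uIcc a α ⊆ Om := OrdConnected.uIcc_subset ordConnected_Icc ha hα
  have h := Convex.norm_image_sub_le_of_norm_hasDerivWithin_le (f := f) (f' := f')
    (s := uIcc a α) (C := C * |α - a| ^ n)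
    (fun t ht => (hf t (hsub ht)).mono hsub) (fun t ht => (hb t (hsub ht)).trans (by
      have := abs_sub_left_of_mem_uIcc ht
      gcongr)) (convex_uIcc a α) left_mem_uIcc right_mem_uIcc
  rw [norm_eq_abs, norm_eq_abs, mul_assoc, ← pow_succ] at h
  exact h

/-- A function whose second derivative is at most `-2c` lies below a parabola through its
critical point. -/
theorem le_sub_mul_sq {f f' f'' : ℝ → ℝ} {l u a c t : ℝ}
    (hf : ∀ t ∈ Icc l u, HasDerivWithinAt f (f' t) (Icc l u) t)
    (hf' : ∀ t ∈ Icc l u, HasDerivWithinAt f' (f'' t) (Icc l u) t)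
    (hle : ∀ t ∈ Icc l u, f'' t ≤ -2 * c) (ha : a ∈ Icc l u) (h0 : f' a = 0) (ht : t ∈ Icc l u) :
    f t ≤ f a - c * (t - a) ^ 2 := by
  have hg : AntitoneOn (fun t => f' t + 2 * c * (t - a)) (Icc l u) := by
    have hd : ∀ t ∈ Icc l u, HasDerivWithinAt (fun t => f' t + 2 * c * (t - a)) (f'' t + 2 * c * 1)
        (Icc l u) t := fun t ht =>
      (hf' t ht).add ((((hasDerivAt_id t).sub_const a).const_mul (2 * c)).hasDerivWithinAt)
    exact antitoneOn_of_hasDerivWithinAt_nonpos (convex_Icc l u)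
      (fun t ht => (hd t ht).continuousWithinAt)
      (fun t ht => (hd t (interior_subset ht)).mono interior_subset)
      fun t ht => by linarith [hle t (interior_subset ht)]
  have hd : ∀ s : Set ℝ, s ⊆ Icc l u → ∀ t ∈ s, HasDerivWithinAt (fun t => f t + c * (t - a) ^ 2)
      (f' t + 2 * c * (t - a)) s t := fun s hs t ht => by
    refine (((hf t (hs ht)).mono hs).add (((((hasDerivAt_id t).sub_const a).pow 2).const_mul
      c).hasDerivWithinAt)).congr_deriv ?_
    simp
    ring
  rcases le_total a t with h | h
  · have hs : Icc a u ⊆ Icc l u := Icc_subset_Icc_left ha.1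
    have := antitoneOn_of_hasDerivWithinAt_nonpos (convex_Icc a u)
      (fun t ht => (hd _ hs t ht).continuousWithinAt)
      (fun t ht => (hd _ hs t (interior_subset ht)).mono interior_subset)
      (fun t ht => by
        have h1 := interior_subset ht
        have := hg ha (hs h1) h1.1
        simpa [h0] using this) (left_mem_Icc.2 ha.2) ⟨h, ht.2⟩ h
    simp only [sub_self] at this
    linarith
  · have hs : Icc l a ⊆ Icc l u := Icc_subset_Icc_right ha.2
    have := monotoneOn_of_hasDerivWithinAt_nonneg (convex_Icc l a)
      (fun t ht => (hd _ hs t ht).continuousWithinAt)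
      (fun t ht => (hd _ hs t (interior_subset ht)).mono interior_subset)
      (fun t ht => by
        have h1 := interior_subset ht
        have := hg (hs h1) ha h1.2
        simpa [h0] using this) ⟨ht.1, h⟩ (right_mem_Icc.2 ha.1) h
    simp only [sub_self] at this
    linarith

/-- The first derivatives of `μ cos`. -/
noncomputable def cosDeriv (μ : ℝ) : ℕ → ℝ → ℝ
  | 0, x => μ * cos x
  | 1, x => -(μ * sin x)
  | 2, x => -(μ * cos x)
  | _, x => μ * sin x

/-- The derivatives of a function that is `C³`-close to a multiple of the cosine. -/
theorem iteratedDerivWithin_near_cos {β : ℝ → ℝ} {μ δ : ℝ} (hβ : ContDiffOn ℝ 3 β Om)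
    (hnorm : ckNorm 3 (fun x => β x - μ * cos x) ≤ δ) {x : ℝ} (hx : x ∈ Om) :
    |β x - μ * cos x| ≤ δ ∧ |iteratedDerivWithin 1 β Om x + μ * sin x| ≤ δ ∧
      |iteratedDerivWithin 2 β Om x + μ * cos x| ≤ δ ∧
      |iteratedDerivWithin 3 β Om x - μ * sin x| ≤ δ := by
  set e : ℝ → ℝ := fun x => β x - μ * cos x with he
  have hcos : ContDiffOn ℝ 3 (fun x => μ * cos x) Om :=
    (contDiff_const.mul contDiff_cos).contDiffOn
  have heC : ContDiffOn ℝ 3 e Om := hβ.sub hcos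
  have hb : ∀ j ≤ 3, |iteratedDerivWithin j e Om x| ≤ δ := fun j hj =>
    (abs_iteratedDerivWithin_le_ckNorm (n := 3) heC hj hx).trans hnorm
  have hcosd : ∀ j ≤ 3, EqOn (iteratedDerivWithin j (fun x => μ * cos x) Om) (cosDeriv μ j) Om :=
    (contDiffOn_three_of_hasDerivWithinAt (d := cosDeriv μ) (fun j hj y _ => by
        interval_cases j
        · exact ((hasDerivAt_cos y).const_mul μ).hasDerivWithinAt.congr_deriv
            (by simp [cosDeriv])
        · exact ((hasDerivAt_sin y).const_mul μ).neg.hasDerivWithinAt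
        · exact ((hasDerivAt_cos y).const_mul μ).neg.hasDerivWithinAt.congr_deriv
            (by simp [cosDeriv]))
      (Continuous.continuousOn (continuous_const.mul continuous_sin))).2
  have hsub : ∀ j ≤ 3, iteratedDerivWithin j e Om x
      = iteratedDerivWithin j β Om x - iteratedDerivWithin j (fun x => μ * cos x) Om x :=
    fun j hj => iteratedDerivWithin_sub hx uniqueDiffOn_Om
      ((hβ x hx).of_le (by exact_mod_cast hj)) ((hcos x hx).of_le (by exact_mod_cast hj))
  have h0 := hb 0 (by norm_num)
  have h1 := hb 1 (by norm_num)
  have h2 := hb 2 (by norm_num)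
  have h3 := hb 3 (by norm_num)
  rw [iteratedDerivWithin_zero] at h0
  rw [hsub 1 (by norm_num), hcosd 1 (by norm_num) hx] at h1
  rw [hsub 2 (by norm_num), hcosd 2 (by norm_num) hx] at h2
  rw [hsub 3 (by norm_num), hcosd 3 (by norm_num) hx] at h3
  simp only [cosDeriv, sub_neg_eq_add] at h1 h2 h3
  exact ⟨h0, h1, h2, h3⟩

/-- A datum close to the cosine satisfies the structural assumptions. -/
theorem exists_isProfile {β : ℝ → ℝ} {μ : ℝ} (hμ : 0 < μ) (hcont : Continuous β)
    (hβ : ContDiffOn ℝ 3 β Om) (hclamp : ∀ x, β (clamp (-π) π x) = β x)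
    (hnorm : ckNorm 3 (fun x => β x - μ * cos x) ≤ 1 / 100 * μ) :
    ∃ m a A : ℝ, m ≤ 2 * μ ∧ IsAmplitude β m ∧
      IsProfile (fun α => 1 - β α / m) (fun α => -(iteratedDerivWithin 1 β Om α) / m) a A := by
  have hπ := pi_gt_three
  have hπ' := pi_lt_d2
  have hnear := fun x (hx : x ∈ Om) => iteratedDerivWithin_near_cos hβ hnorm hx
  have h0mem : (0 : ℝ) ∈ Om := ⟨by linarith, by linarith⟩
  obtain ⟨a, haO, hmax⟩ := (isCompact_Icc (a := -π) (b := π)).exists_isMaxOn ⟨0, h0mem⟩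
    hcont.continuousOn
  replace haO : a ∈ Om := haO
  have hcosa : 98 / 100 ≤ cos a := by
    have h1 : β 0 ≤ β a := hmax h0mem
    have h2 := abs_le.1 (hnear 0 h0mem).1
    have h3 := abs_le.1 (hnear a haO).1
    rw [cos_zero] at h2
    have h4 : 98 / 100 * μ ≤ cos a * μ := by linarith [h2.1, h3.2]
    exact le_of_mul_le_mul_right h4 hμ
  have haa : |a| ≤ 1 / 3 := by
    have h1 := cos_le_one_sub_mul_cos_sq (abs_le.2 ⟨haO.1, haO.2⟩)
    have h2 : 2 / π ^ 2 * a ^ 2 ≤ 2 / 100 := by linarith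
    rw [div_mul_eq_mul_div, div_le_iff₀ (by positivity)] at h2
    refine abs_le_of_sq_le_sq ?_ (by norm_num)
    nlinarith
  obtain ⟨ha1, ha2⟩ := abs_le.1 haa
  set m := β a with hm
  set k := -iteratedDerivWithin 2 β Om a with hk
  have hmb : 97 / 100 * μ ≤ m ∧ m ≤ 101 / 100 * μ := by
    have h3 := abs_le.1 (hnear a haO).1
    have h4 := mul_le_mul_of_nonneg_left hcosa hμ.le
    have h5 := mul_le_mul_of_nonneg_left (cos_le_one a) hμ.le
    constructor <;> linarith [h3.1, h3.2]
  have hkb : 97 / 100 * μ ≤ k ∧ k ≤ 101 / 100 * μ := by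
    have h3 := abs_le.1 (hnear a haO).2.2.1
    have h4 := mul_le_mul_of_nonneg_left hcosa hμ.le
    have h5 := mul_le_mul_of_nonneg_left (cos_le_one a) hμ.le
    constructor <;> linarith [h3.1, h3.2]
  have hm0 : 0 < m := by linarith [hmb.1]
  have hd : ∀ j < 3, ∀ x ∈ Om, HasDerivWithinAt (iteratedDerivWithin j β Om)
      (iteratedDerivWithin (j + 1) β Om x) Om x := fun j hj x hx =>
    hasDerivWithinAt_iteratedDerivWithin hβ hj hx
  have hd0 : ∀ x ∈ Om, HasDerivWithinAt β (iteratedDerivWithin 1 β Om x) Om x := fun x hx => by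
    have := hd 0 (by norm_num) x hx
    rwa [iteratedDerivWithin_zero] at this
  have hnhds : Om ∈ 𝓝 a := Icc_mem_nhds (by linarith) (by linarith)
  have hcrit : iteratedDerivWithin 1 β Om a = 0 :=
    (hmax.isLocalMax hnhds).hasDerivAt_eq_zero ((hd0 a haO).hasDerivAt hnhds)
  -- Taylor expansion at the maximum
  have t2 : ∀ α ∈ Om, |iteratedDerivWithin 2 β Om α - -k| ≤ 101 / 100 * μ * |α - a| ^ 1 := by
    intro α hα
    have := abs_sub_le_pow_succ (n := 0) (C := 101 / 100 * μ) (by positivity) haO hα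
      (hd 2 (by norm_num)) fun t ht => by
        have h3 := abs_le.1 (hnear t ht).2.2.2
        have h4 := abs_le.1 (abs_sin_le_one t)
        rw [pow_zero, mul_one, abs_le]
        constructor <;> nlinarith [h3.1, h3.2, h4.1, h4.2]
    simpa [hk] using this
  have t1 : ∀ α ∈ Om, |iteratedDerivWithin 1 β Om α - -k * (α - a)|
      ≤ 101 / 100 * μ * |α - a| ^ 2 := by
    intro α hα
    have := abs_sub_le_pow_succ (n := 1) (C := 101 / 100 * μ)
      (f := fun t => iteratedDerivWithin 1 β Om t - -k * (t - a)) (by positivity) haO hα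
      (fun t ht => (hd 1 (by norm_num) t ht).sub
        (((hasDerivAt_id t).sub_const a).const_mul (-k)).hasDerivWithinAt)
      fun t ht => by rw [mul_one]; exact t2 t ht
    simpa [hcrit] using this
  have t0 : ∀ α ∈ Om, |β α - m - -k * (α - a) ^ 2 / 2| ≤ 101 / 100 * μ * |α - a| ^ 3 := by
    intro α hα
    have := abs_sub_le_pow_succ (n := 2) (C := 101 / 100 * μ)
      (f := fun t => β t - -k * (t - a) ^ 2 / 2)
      (f' := fun t => iteratedDerivWithin 1 β Om t - -k * (t - a)) (by positivity) haO hα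
      (fun t ht => by
        refine ((hd0 t ht).sub (((((hasDerivAt_id t).sub_const a).pow 2).const_mul
          (-k)).div_const 2).hasDerivWithinAt).congr_deriv ?_
        simp
        ring)
      fun t ht => t1 t ht
    convert this using 2
    simp [hm]
    ring
  have hxb : ∀ α ∈ Om, (α - a) ^ 2 ≤ 25 / 2 := fun α hα => by
    have h1 : |α - a| ≤ 7 / 2 := abs_le.2 ⟨by linarith [hα.1], by linarith [hα.2]⟩
    rw [← sq_abs]
    nlinarith [abs_nonneg (α - a)]
  -- For `|α| ≤ 1` concavity is used: `cos ≥ 1/2` gives `β'' ≤ -(49/100) μ`. For `|α| ≥ 1` the bound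
  -- `cos α ≤ 5/9` keeps `β` well below `m`, while `(α - a)²/40` is at most `5/16`.
  have hquad : ∀ α ∈ Om, m * (α - a) ^ 2 / 40 ≤ m - β α := by
    intro α hα
    rcases le_total |α| 1 with h1 | h1
    · have hsub : Icc (-1 : ℝ) 1 ⊆ Om := Icc_subset_Icc (by linarith) (by linarith)
      have := le_sub_mul_sq (l := -1) (u := 1) (a := a) (c := 245 / 1000 * μ) (t := α)
        (fun t ht => (hd0 t (hsub ht)).mono hsub)
        (fun t ht => (hd 1 (by norm_num) t (hsub ht)).mono hsub) (fun t ht => by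
          have h2 := abs_le.1 (hnear t (hsub ht)).2.2.1
          have h3 := one_sub_sq_div_two_le_cos (x := t)
          have h4 : 1 / 2 ≤ cos t := by nlinarith [ht.1, ht.2]
          nlinarith [h2.2]) ⟨by linarith, by linarith⟩ hcrit (abs_le.1 h1)
      rw [← hm] at this
      nlinarith [hmb.2, sq_nonneg (α - a), mul_le_mul_of_nonneg_right hmb.2 (sq_nonneg (α - a)),
        mul_nonneg hμ.le (sq_nonneg (α - a))]
    · have h2 : cos α ≤ 5 / 9 := by
        rw [← cos_abs]
        exact (cos_le_cos_of_nonneg_of_le_pi zero_le_one (abs_le.2 hα) h1).trans cos_one_le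
      have h3 := abs_le.1 (hnear α hα).1
      have h4 := mul_le_mul_of_nonneg_left (hxb α hα) hm0.le
      nlinarith [hmb.1, hmb.2, h3.2]
  -- The curvature of `1 - β/m` at its zero is `k/m`, so the quadratic coefficient is `k/(2m)`.
  refine ⟨m, a, k / (2 * m), by linarith [hmb.2], ⟨hcont, hm0, ?_, ?_⟩,
    ⟨?_, by linarith, ?_, ?_, ?_, ?_, ?_⟩⟩
  · intro α
    rw [← hclamp α]
    have h3 := abs_le.1 (hnear _ (clamp_mem_Om α)).1
    have h4 := mul_le_mul_of_nonneg_left (neg_one_le_cos (clamp (-π) π α)) hμ.le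
    linarith [h3.1, hmb.1]
  · intro α
    rw [← hclamp α]
    exact hmax (clamp_mem_Om α)
  · fun_prop
  · rw [le_div_iff₀ (by positivity)]
    linarith [hmb.2, hkb.1]
  · rw [div_le_iff₀ (by positivity)]
    linarith [hmb.1, hkb.2]
  · intro α hα
    have := hquad α hα
    rw [show 1 - β α / m = (m - β α) / m by field_simp, le_div_iff₀ hm0]
    linarith
  · intro α hα
    have := t0 α hα
    rw [show 1 - β α / m - k / (2 * m) * (α - a) ^ 2 = -((β α - m - -k * (α - a) ^ 2 / 2) / m) by
      field_simp; ring, abs_neg, abs_div, abs_of_pos hm0, div_le_iff₀ hm0]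
    have h5 : 0 ≤ |α - a| ^ 3 := by positivity
    nlinarith [mul_le_mul_of_nonneg_right hmb.1 h5, mul_nonneg hμ.le h5]
  · intro α hα
    have := t1 α hα
    rw [show -iteratedDerivWithin 1 β Om α / m - 2 * (k / (2 * m)) * (α - a)
      = -((iteratedDerivWithin 1 β Om α - -k * (α - a)) / m) by
      field_simp; ring, abs_neg, abs_div, abs_of_pos hm0, div_le_iff₀ hm0]
    rw [sq_abs] at this
    have h5 := sq_nonneg (α - a)
    nlinarith [mul_le_mul_of_nonneg_right hmb.1 h5, mul_nonneg hμ.le h5]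

/-! ### Norm estimates, existence, blow-up and maximality -/

theorem ckNorm_zero_le {f : ℝ → ℝ} {M : ℝ} (h : ∀ x ∈ Om, |f x| ≤ M) : ckNorm 0 f ≤ M := by
  have : Nonempty Om := ⟨⟨π, pi_mem_Om⟩⟩
  simp only [ckNorm, zero_add, Finset.sum_range_one, iteratedDerivWithin_zero]
  exact ciSup_le fun x => h x x.2

/-- The `C¹` norm of a mean-free function is controlled by its derivative. -/
theorem ckNorm_one_le_of_integral_eq_zero {f f' : ℝ → ℝ} {L : ℝ} (hf : ContinuousOn f Om)
    (hd : ∀ x ∈ Om, HasDerivWithinAt f (f' x) Om x) (hL : ∀ x ∈ Om, |f' x| ≤ L)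
    (hmean : ∫ y in (-π)..π, f y = 0) : ckNorm 1 f ≤ 8 * L := by
  have hπ := pi_gt_three
  have hπ' := pi_lt_d2
  have : Nonempty Om := ⟨⟨π, pi_mem_Om⟩⟩
  have hL0 : 0 ≤ L := (abs_nonneg _).trans (hL π pi_mem_Om)
  have h1 : ∀ x ∈ Om, |f x| ≤ 2 * π * L := by
    -- With mean zero, `2π f(x)` is the integral of `f(x) - f(y)`, and each difference is at most
    -- `2π L`. The factor `8` then covers `2π + 1`.
    intro x hx
    have hi : IntervalIntegrable f volume (-π) π := by
      refine ContinuousOn.intervalIntegrable ?_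
      rwa [uIcc_of_le (by linarith)]
    have e1 : ∫ y in (-π)..π, (f x - f y) = 2 * π * f x := by
      rw [intervalIntegral.integral_sub (by simp) hi, hmean, intervalIntegral.integral_const,
        smul_eq_mul]
      ring
    have e2 : ‖∫ y in (-π)..π, (f x - f y)‖ ≤ 2 * π * L * |π - -π| := by
      refine intervalIntegral.norm_integral_le_of_norm_le_const fun y hy => ?_
      rw [uIoc_of_le (by linarith)] at hy
      have hyO : y ∈ Om := ⟨hy.1.le, hy.2⟩
      have e3 := (convex_Icc (-π) π).norm_image_sub_le_of_norm_hasDerivWithin_le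
        (f := f) (f' := f') (C := L) hd hL hyO hx
      have e4 : ‖x - y‖ ≤ 2 * π := by
        rw [norm_eq_abs, abs_le]
        constructor <;> linarith [hx.1, hx.2, hyO.1, hyO.2]
      nlinarith [mul_le_mul_of_nonneg_left e4 hL0]
    rw [e1, norm_eq_abs, abs_mul, abs_of_pos (by linarith : 0 < 2 * π), sub_neg_eq_add,
      abs_of_pos (by linarith : 0 < π + π)] at e2
    have e5 : 2 * π * |f x| ≤ 2 * π * (2 * π * L) := by linarith
    exact le_of_mul_le_mul_left e5 (by linarith)
  have h2 : ckNorm 1 f = (⨆ x : Om, |f x|) + ⨆ x : Om, |iteratedDerivWithin 1 f Om x| := by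
    simp [ckNorm, Finset.sum_range_succ]
  have h3 : (⨆ x : Om, |f x|) ≤ 2 * π * L := ciSup_le fun x => h1 x x.2
  have h4 : (⨆ x : Om, |iteratedDerivWithin 1 f Om x|) ≤ L := ciSup_le fun x => by
    rw [iteratedDerivWithin_one, (hd x x.2).derivWithin (uniqueDiffOn_Om x x.2)]
    exact hL x x.2
  rw [h2]
  nlinarith

/-- Factoring out `1/(τs - τ)` leaves `1 - K (τs - τ)^(1/4)`, which tends to one. -/
theorem tendsto_inv_sub_rpow {τs K : ℝ} :
    Tendsto (fun τ => 1 / (τs - τ) - K * (τs - τ) ^ (-(3 / 4) : ℝ)) (𝓝[<] τs) atTop := by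
  have hpos : ∀ᶠ τ in 𝓝[<] τs, 0 < τs - τ := by
    filter_upwards [self_mem_nhdsWithin] with τ hτ
    exact sub_pos.2 hτ
  have h0 : Tendsto (fun τ => τs - τ) (𝓝[<] τs) (𝓝 0) := by
    have : Tendsto (fun τ => τs - τ) (𝓝 τs) (𝓝 (τs - τs)) := by
      exact (continuous_const.sub continuous_id).tendsto τs
    rw [sub_self] at this
    exact this.mono_left nhdsWithin_le_nhds
  have h1 : Tendsto (fun τ => (τs - τ)⁻¹) (𝓝[<] τs) atTop :=
    tendsto_inv_nhdsGT_zero.comp (tendsto_nhdsWithin_iff.2 ⟨h0, hpos⟩)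
  have h2 : Tendsto (fun τ => 1 - K * (τs - τ) ^ (1 / 4 : ℝ)) (𝓝[<] τs) (𝓝 1) := by
    have := (h0.rpow_const (p := 1 / 4) (Or.inr (by norm_num))).const_mul K
    simpa using this.const_sub 1
  refine (h1.atTop_mul_pos one_pos h2).congr' ?_
  filter_upwards [hpos] with τ hτ
  have : (τs - τ) ^ (-(3 / 4) : ℝ) = (τs - τ)⁻¹ * (τs - τ) ^ (1 / 4 : ℝ) := by
    rw [← rpow_neg_one, ← rpow_add hτ]
    norm_num
  rw [this]
  ring

/-- The cosine is mean-free on `[-π, π]`, as is the solution, so the derivative estimate gives the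
`C¹` bound. The constant covers `8 · 2 · 3200000000000`, the `2` coming from `m ≤ 2 μ`. -/
theorem exists_maximal_solution {β : ℝ → ℝ} {μ : ℝ} (hμ : 0 < μ) (hcont : Continuous β)
    (hβ : ContDiffOn ℝ 3 β Om) (hclamp : ∀ x, β (clamp (-π) π x) = β x)
    (hmean : ∫ x in (-π)..π, β x = 0)
    (hnorm : ckNorm 3 (fun x => β x - μ * cos x) ≤ 1 / 100 * μ) :
    ∃ τs : ℝ, 0 < τs ∧ ∃ b : ℝ → ℝ → ℝ, IsC3Solution β τs b ∧
      (∀ τ ∈ Ico 0 τs, (∫ x in (-π)..π, b τ x) = 0) ∧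
      ∀ τ ∈ Ico 0 τs, ckNorm 1 (fun x => b τ x - cos x / (τs - τ))
        ≤ 60000000000000 * μ ^ (1 / 4 : ℝ) * (τs - τ) ^ (-(3 / 4) : ℝ) := by
  obtain ⟨m, a, A, hmμ, h, hp⟩ := exists_isProfile hμ hcont hβ hclamp hnorm
  have hm := h.pos
  obtain ⟨τs, hτs, himage, hasym⟩ := h.exists_blowup_time hp
  have hsub : Ico 0 τs ⊆ physTime β '' paramRange m := by
    rw [← himage]; exact image_mono h.Ico_subset
  refine ⟨τs, hτs, fun τ x => vel β (param β m τ) x, h.isC3Solution hβ hmean hsub,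
    fun τ hτ => h.integral_vel_eq_zero (param_mem (hsub hτ)), ?_⟩
  intro τ hτ
  obtain ⟨η, hη, rfl⟩ : τ ∈ physTime β '' Ico 0 (1 / m) := by rwa [himage]
  have hη' := h.Ico_subset hη
  dsimp only
  rw [h.param_physTime hη']
  set σ := τs - physTime β η
  have hσ0 : 0 < σ := sub_pos.2 hτ.2
  obtain ⟨h1, h2⟩ := hasym η hη
  have hC : Continuous fun x => vel β η x - cos x / σ :=
    (h.continuous_vel hη').sub (continuous_cos.div_const σ)
  have key := ckNorm_one_le_of_integral_eq_zero (f := fun x => vel β η x - cos x / σ)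
    (f' := fun x => velDeriv β η 1 x + sin x / σ) hC.continuousOn
    (fun x hx => by
      refine ((h.hasDerivWithinAt_velDeriv hβ hη' (show 0 < 3 by norm_num) hx).sub
        ((hasDerivAt_cos x).div_const σ).hasDerivWithinAt).congr_deriv ?_
      ring)
    (fun x hx => h.abs_velDeriv_add_le hp (fun α _ => by field_simp) hη h1 h2 hx)
    (by
      rw [intervalIntegral.integral_sub ((h.continuous_vel hη').intervalIntegrable _ _)
        ((continuous_cos.div_const σ).intervalIntegrable _ _), h.integral_vel_eq_zero hη',
        intervalIntegral.integral_div, integral_cos]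
      simp)
  refine key.trans ?_
  have h3 : m ^ (1 / 4 : ℝ) ≤ 2 * μ ^ (1 / 4 : ℝ) := by
    refine (rpow_le_rpow hm.le hmμ (by norm_num)).trans ?_
    rw [mul_rpow (by norm_num) hμ.le]
    refine mul_le_mul_of_nonneg_right ?_ (rpow_nonneg hμ.le _)
    exact (rpow_le_rpow_of_exponent_le (by norm_num) (by norm_num : (1 / 4 : ℝ) ≤ 1)).trans
      (rpow_one _).le
  have h4 : 0 ≤ σ ^ (-(3 / 4) : ℝ) := rpow_nonneg hσ0.le _
  have h5 := mul_le_mul_of_nonneg_right h3 h4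
  have h6 : 0 ≤ μ ^ (1 / 4 : ℝ) * σ ^ (-(3 / 4) : ℝ) := mul_nonneg (rpow_nonneg hμ.le _) h4
  linarith

/-- At `x = 0` the cosine is one, and the leading term `1/(τs - τ)` dominates the remainder. -/
theorem tendsto_ckNorm_zero {b₀ : ℝ → ℝ} {b : ℝ → ℝ → ℝ} {τs K : ℝ} (hτs : 0 < τs)
    (hb : IsC3Solution b₀ τs b)
    (hasym : ∀ τ ∈ Ico 0 τs, ckNorm 1 (fun x => b τ x - cos x / (τs - τ))
      ≤ K * (τs - τ) ^ (-(3 / 4) : ℝ)) :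
    Tendsto (fun τ => ckNorm 0 (b τ)) (𝓝[<] τs) atTop := by
  refine tendsto_atTop_mono' _ ?_ (tendsto_inv_sub_rpow (τs := τs) (K := K))
  filter_upwards [Ico_mem_nhdsLT hτs] with τ hτ
  have h0 : (0 : ℝ) ∈ Om := ⟨by linarith [pi_pos], pi_pos.le⟩
  have hC := hb.contDiffOn τ hτ
  have h1 := abs_iteratedDerivWithin_le_ckNorm (n := 0) (hC.of_le (by norm_num)) le_rfl h0
  have h2 : ContDiffOn ℝ 1 (fun x => b τ x - cos x / (τs - τ)) Om :=
    (hC.of_le (by norm_num)).sub (contDiff_cos.div_const _).contDiffOn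
  have h3 := abs_iteratedDerivWithin_le_ckNorm (n := 1) h2 zero_le_one h0
  rw [iteratedDerivWithin_zero] at h1 h3
  rw [cos_zero] at h3
  have h4 := (abs_le.1 (h3.trans (hasym τ hτ))).1
  linarith [le_abs_self (b τ 0)]

end ReducedIPM

theorem theorem1p1 :
    ∃ δ : ℝ, 0 < δ ∧ ∃ C : ℝ, 0 < C ∧
      ∀ μ : ℝ, 0 < μ → ∀ b₀ : ℝ → ℝ,
        ContDiffOn ℝ 3 b₀ ReducedIPM.Om →
        (∫ x in (-Real.pi)..Real.pi, b₀ x) = 0 →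
        ReducedIPM.ckNorm 3 (fun x => b₀ x - μ * Real.cos x) ≤ δ * μ →
        ∃ τs : ℝ, 0 < τs ∧ ∃ b : ℝ → ℝ → ℝ,
          ReducedIPM.IsC3Solution b₀ τs b ∧
          (∀ τ ∈ Set.Ico 0 τs, (∫ x in (-Real.pi)..Real.pi, b τ x) = 0) ∧
          (∀ (T : ℝ) (b' : ℝ → ℝ → ℝ), ReducedIPM.IsC3Solution b₀ T b' →
            T ≤ τs ∧ ∀ τ ∈ Set.Ico 0 T, ∀ x ∈ ReducedIPM.Om, b' τ x = b τ x) ∧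
          Filter.Tendsto (fun τ => ReducedIPM.ckNorm 0 (b τ)) (nhdsWithin τs (Set.Iio τs))
            Filter.atTop ∧
          ∀ τ ∈ Set.Ico 0 τs,
            ReducedIPM.ckNorm 1 (fun x => b τ x - Real.cos x / (τs - τ))
              ≤ C * μ ^ (1 / 4 : ℝ) * (τs - τ) ^ (-(3 / 4) : ℝ) := by
  refine ⟨1 / 100, by norm_num, 60000000000000, by norm_num, fun μ hμ b₀ hb₀ hmean hnorm => ?_⟩
  -- The constant extension beyond `±π` makes the datum continuous on the line with the same range;
  -- smoothness is only ever used within `Om`.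
  set β : ℝ → ℝ := fun x => b₀ (ReducedIPM.clamp (-Real.pi) Real.pi x) with hβ
  have hEq : ∀ x ∈ ReducedIPM.Om, β x = b₀ x := fun x hx => by
    simp only [hβ, ReducedIPM.clamp_of_mem hx]
  have hcont : Continuous β :=
    hb₀.continuousOn.comp_continuous (ReducedIPM.continuous_clamp _ _) ReducedIPM.clamp_mem_Om
  obtain ⟨τs, hτs, b, hb, hbmean, hasym⟩ := ReducedIPM.exists_maximal_solution hμ hcont
    (hb₀.congr hEq) (fun x => hEq _ (ReducedIPM.clamp_mem_Om x))
    (by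
      rw [← hmean]
      refine intervalIntegral.integral_congr fun x hx => hEq x ?_
      rwa [uIcc_of_le (by linarith [Real.pi_pos])] at hx)
    (by
      refine le_of_eq_of_le ?_ hnorm
      refine Finset.sum_congr rfl fun j _ => ?_
      congr 1
      ext x
      rw [iteratedDerivWithin_congr (fun y hy => by rw [hEq y hy]) x.2])
  have hb' : ReducedIPM.IsC3Solution b₀ τs b :=
    ⟨hb.contDiffOn, hb.continuousOn, fun x hx => (hb.initial x hx).trans (hEq x hx), hb.equation⟩
  have hblow := ReducedIPM.tendsto_ckNorm_zero hτs hb' hasym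
  refine ⟨τs, hτs, b, hb', hbmean, fun T b' hsol => ?_, hblow, hasym⟩
  have hT : T ≤ τs := by
    -- A solution living past `τs` is bounded on the compact set `[0, τs] × Om`, yet it agrees with
    -- `b` before `τs`, where the supremum of `|b|` is unbounded.
    by_contra! hlt
    have hsub : Icc 0 τs ×ˢ ReducedIPM.Om ⊆ Ico 0 T ×ˢ ReducedIPM.Om :=
      prod_mono (fun s hs => ⟨hs.1, hs.2.trans_lt hlt⟩) subset_rfl
    obtain ⟨M, hM⟩ := (isCompact_Icc.prod isCompact_Icc).exists_bound_of_continuousOn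
      ((hsol.continuousOn 0 (by norm_num)).mono hsub)
    have hnear : ∀ᶠ τ in 𝓝[<] τs, τ ∈ Ico 0 τs := Ico_mem_nhdsLT hτs
    obtain ⟨τ, hτ, hτM⟩ := (hnear.and (hblow.eventually_gt_atTop M)).exists
    refine absurd (ReducedIPM.ckNorm_zero_le fun x hx => ?_) (not_le.2 hτM)
    rw [← hsol.eqOn hb' hbmean ⟨hτ.1, hτ.2.trans hlt⟩ hτ hx]
    simpa using hM (τ, x) ⟨Ico_subset_Icc_self hτ, hx⟩
  exact ⟨hT, fun τ hτ x hx => hsol.eqOn hb' hbmean hτ ⟨hτ.1, hτ.2.trans_le hT⟩ hx⟩
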